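/- Let $U\subset\mathbb{R}^n$ be open and let $\psi_d(U)$ be the set of all (possibly empty, possibly non-compact) smooth $d$-dimensional submanifolds $W\subset U$ without boundary which are proper in $U$, i.e. $W\cap K$ is compact for every compact $K\subset U$. For $W\in\psi_d(U)$ let $NW=\{(x,v)\mid x\in W,\ v\perp T_xW\}$ be the normal bundle and let $\exp_W(x,v)=x+v$, defined for those $(x,v)\in NW$ such that the segment from $x$ to $x+v$ lies in $U$. For a smooth section $f$ of $NW$ over an open subset of $W$, let $\tau\circ(Df)(x)\colon T_xW\to N_xW$ be the normal component of the derivative of $f$ at $x$. The space $\widetilde\Psi_d(U)$ is $\psi_d(U)$ with the topology in which a neighbourhood basis of $W$ is given by the sets $(K,\epsilon)^{\mathrm{ls}}$, for $K\subset U$ compact and $\epsilon>0$; here $W'\in(K,\epsilon)^{\mathrm{ls}}$ if there is a subset $Q\subset NW$ contained in the domain of $\exp_W$ such that the projection $q\colon Q\to W$ (1) hits every point of $W\cap K$, (2) is a local diffeomorphism, and a covering map onto its image, (3) $\exp_W(Q)\cap K=W'\cap K$, and (4) $\|f(x)\|+\|\tau\circ(Df)(x)\|<\epsilon$ for each smooth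 local section $f$ of $q$ and each $x$ in its domain. The ($C^1$) Galatius--Randal-Williams topology on $\psi_d(U)$ has as neighbourhood basis of $W$ the sets $(K,\epsilon)^{\mathrm{gs}}$, for $K\subset U$ compact and $\epsilon>0$; here $W'\in(K,\epsilon)^{\mathrm{gs}}$ if there is a smooth section $f\colon W\to NW$ with values in the domain of $\exp_W$ such that $\exp_W(f(W))\cap K=W'\cap K$ and $\|f(x)\|+\|\tau\circ(Df)(x)\|<\epsilon$ for all $x\in W$ such that $x\in K$ or $\exp_W(f(x))\in K$. The Fell topology on the set $\mathrm{CL}(X)$ of closed subsets of a space $X$ has as subbasis the sets $\{A\mid A\cap O\neq\emptyset\}$ with $O\subset X$ open and $\{A\mid A\cap C=\emptyset\}$ with $C\subset X$ compact. The differential Fell topology on $\psi_d(U)$ is the pullback of the Fell topology on $\mathrm{CL}(U\times\mathrm{Gr}_d(\mathbb{R}^n))$ along the map $W\mapsto\{(x,T_xW)\mid x\in W\}$. Theorem. The topology of $\widetilde\Psi_d(U)$ is the differential Fell topology; in particular, the sets $(K,\epsilon)^{\mathrm{ls}}$ form a neighbourhood basis of $W$ in the differential Fell topology, for every $W\in\psi_d(U)$.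 Consequently the differential Fell topology is coarser than the Galatius--Randal-Williams topology, and it is strictly coarser if $d<n$ and $U\neq\emptyset$. -/

import Mathlib

open Set Filter Topology
open scoped ContDiff

namespace SubmanifoldSpace

section

/- `E` is a Euclidean space; it is `ℝⁿ` in the applications. -/
variable {E : Type*} [NormedAddCommGroup E] [InnerProductSpace ℝ E] [FiniteDimensional ℝ E]

/-! ### Proper submanifolds and their tangent spaces -/

/-- `Φ` is a smooth slice chart of `W`: a diffeomorphism between open subsets of `E`, carrying
`W` (inside its source) to a `d`-dimensional linear subspace `L` (inside its target). -/
structure IsSliceChart (d : ℕ) (W : Set E)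
    (Φ : OpenPartialHomeomorph E E) (L : Submodule ℝ E) : Prop where
  finrank_eq : Module.finrank ℝ L = d
  contDiffOn : ContDiffOn ℝ ∞ Φ Φ.source
  contDiffOn_symm : ContDiffOn ℝ ∞ Φ.symm Φ.target
  mem_iff : ∀ y ∈ Φ.source, y ∈ W ↔ Φ y ∈ L

/-- `W` is a smooth `d`-dimensional submanifold (without boundary, possibly empty) of `E`. -/
def IsSubmanifold (d : ℕ) (W : Set E) : Prop :=
  ∀ x ∈ W, ∃ (Φ : OpenPartialHomeomorph E E) (L : Submodule ℝ E),
    x ∈ Φ.source ∧ IsSliceChart d W Φ L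

/-- The set `ψ_d(U)` of proper (possibly empty, possibly non-compact) smooth `d`-dimensional
submanifolds of `U` without boundary. -/
structure ProperSubmanifold (d : ℕ) (U : TopologicalSpace.Opens E) where
  carrier : Set E
  subset : carrier ⊆ U
  proper : ∀ K : Set E, IsCompact K → K ⊆ U → IsCompact (carrier ∩ K)
  isSubmanifold : IsSubmanifold d carrier

/-- The tangent space `T_x W`: the linear span of the velocities at `x` of curves in `W`. (For a
submanifold the velocities already form a linear subspace.) -/
def tangentSpace (W : Set E) (x : E) : Submodule ℝ E :=
  Submodule.span ℝ {v | ∃ γ : ℝ → E, γ 0 = x ∧ (∀ᶠ t in 𝓝 0, γ t ∈ W) ∧ HasDerivAt γ v 0}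

/-- The Grassmannian `Gr_d(E)` of `d`-dimensional linear subspaces of `E`. -/
def Gr (E : Type*) [NormedAddCommGroup E] [InnerProductSpace ℝ E] (d : ℕ) : Type _ := {L : Submodule ℝ E // Module.finrank ℝ L = d}

/-- The usual topology of the Grassmannian, from the embedding that takes a subspace to the
orthogonal projection onto it. -/
noncomputable instance (d : ℕ) : TopologicalSpace (Gr E d) :=
  TopologicalSpace.induced (fun L => L.1.starProjection) inferInstance

set_option linter.unusedSectionVars false in
theorem IsSliceChart.exists_equiv {d : ℕ} {W : Set E}
    {Φ : OpenPartialHomeomorph E E} {L : Submodule ℝ E}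
    (h : IsSliceChart d W Φ L) {x : E} (hx : x ∈ Φ.source) :
    ∃ e : E ≃L[ℝ] E, HasFDerivAt Φ (e : E →L[ℝ] E) x ∧
      HasFDerivAt Φ.symm (e.symm : E →L[ℝ] E) (Φ x) := by
  have h1 : HasFDerivAt Φ (fderiv ℝ Φ x) x :=
    ((h.contDiffOn.contDiffAt (Φ.open_source.mem_nhds hx)).differentiableAt (by simp)).hasFDerivAt
  have h2 : HasFDerivAt Φ.symm (fderiv ℝ Φ.symm (Φ x)) (Φ x) :=
    ((h.contDiffOn_symm.contDiffAt
      (Φ.open_target.mem_nhds (Φ.map_source hx))).differentiableAt (by simp)).hasFDerivAt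
  have h3 : (fderiv ℝ Φ.symm (Φ x)).comp (fderiv ℝ Φ x) = ContinuousLinearMap.id ℝ _ := by
    have := h2.comp x h1
    refine this.unique ((hasFDerivAt_id x).congr_of_eventuallyEq ?_)
    filter_upwards [Φ.open_source.mem_nhds hx] with y hy using Φ.left_inv hy
  have h4 : (fderiv ℝ Φ x).comp (fderiv ℝ Φ.symm (Φ x)) = ContinuousLinearMap.id ℝ _ := by
    have h1' : HasFDerivAt Φ (fderiv ℝ Φ x) (Φ.symm (Φ x)) := by rwa [Φ.left_inv hx]
    have := h1'.comp (Φ x) h2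
    refine this.unique ((hasFDerivAt_id (Φ x)).congr_of_eventuallyEq ?_)
    filter_upwards [Φ.open_target.mem_nhds (Φ.map_source hx)] with y hy using Φ.right_inv hy
  exact ⟨ContinuousLinearEquiv.equivOfInverse _ _ (fun v => DFunLike.congr_fun h3 v)
    (fun v => DFunLike.congr_fun h4 v), h1, h2⟩

theorem IsSliceChart.mem_tangentSpace {d : ℕ} {W : Set E}
    {Φ : OpenPartialHomeomorph E E} {L : Submodule ℝ E}
    (h : IsSliceChart d W Φ L) {x : E} (hx : x ∈ Φ.source) (hW : x ∈ W)
    (e : E ≃L[ℝ] E) (he : HasFDerivAt Φ (e : E →L[ℝ] E) x)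
    (he' : HasFDerivAt Φ.symm (e.symm : E →L[ℝ] E) (Φ x)) :
    tangentSpace W x = L.comap (e.toLinearEquiv : E →ₗ[ℝ] E) := by
  apply le_antisymm
  · refine Submodule.span_le.2 ?_
    rintro v ⟨γ, h0, hγ, hv⟩
    change e v ∈ L
    have h1 : HasDerivAt (fun t => Φ (γ t)) (e v) 0 := by
      have he0 : HasFDerivAt Φ (e : E →L[ℝ] E) (γ 0) := by rwa [h0]
      exact he0.comp_hasDerivAt 0 hv
    have hs : ∀ᶠ t in 𝓝 (0 : ℝ), γ t ∈ Φ.source :=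
      hv.continuousAt.eventually_mem (Φ.open_source.mem_nhds (by rwa [h0]))
    have hL : ∀ᶠ t in 𝓝 (0 : ℝ), Φ (γ t) ∈ L := by
      filter_upwards [hs, hγ] with t ht ht' using (h.mem_iff _ ht).1 ht'
    have hcl : IsClosed (L : Set E) := L.closed_of_finiteDimensional
    have ht := h1.tendsto_slope_zero
    refine hcl.mem_of_tendsto ht ?_
    filter_upwards [nhdsWithin_le_nhds hL] with t ht'
    refine L.smul_mem _ (L.sub_mem ?_ ?_)
    · simpa using ht'
    · exact hL.self_of_nhds
  · intro v hv
    have hv : e v ∈ L := hv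
    have hxL : Φ x ∈ L := (h.mem_iff x hx).1 hW
    refine Submodule.subset_span ⟨fun t => Φ.symm (Φ x + t • e v), by simp [Φ.left_inv hx], ?_, ?_⟩
    · have hc : ContinuousAt (fun t : ℝ => Φ x + t • e v) 0 := by fun_prop
      have hev : ∀ᶠ t in 𝓝 (0 : ℝ), Φ x + t • e v ∈ Φ.target :=
        hc.eventually_mem (Φ.open_target.mem_nhds (by simpa using Φ.map_source hx))
      filter_upwards [hev] with t ht
      rw [h.mem_iff _ (Φ.map_target ht), Φ.right_inv ht]
      exact L.add_mem hxL (L.smul_mem _ hv)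
    · have hl : HasDerivAt (fun t : ℝ => Φ x + t • e v) (e v) 0 := by
        simpa using ((hasDerivAt_id (0 : ℝ)).smul_const (e v)).const_add (Φ x)
      have he0 : HasFDerivAt Φ.symm (e.symm : E →L[ℝ] E) (Φ x + (0 : ℝ) • e v) := by
        simpa using he'
      have hd := he0.comp_hasDerivAt 0 hl
      have hev : (e.symm : E →L[ℝ] E) (e v) = v := e.symm_apply_apply v
      rw [hev] at hd
      exact hd

theorem finrank_tangentSpace {d : ℕ} {W : Set E} (hW : IsSubmanifold d W)
    {x : E} (hx : x ∈ W) : Module.finrank ℝ (tangentSpace W x) = d := by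
  obtain ⟨Φ, L, hxs, h⟩ := hW x hx
  obtain ⟨e, he, he'⟩ := h.exists_equiv hxs
  rw [h.mem_tangentSpace hxs hx e he he', ← h.finrank_eq]
  exact (Submodule.comap_equiv_eq_map_symm e.toLinearEquiv L) ▸
    (e.toLinearEquiv.symm.finrank_map_eq L)

/-! ### The Fell topology, the Gauss image and the differential Fell topology -/

/-- The Fell topology on the set `CL(X)` of closed subsets of `X`: the subbasic open sets are
`{A | A ∩ O ≠ ∅}` for `O` open, and `{A | A ⊆ Cᶜ}` for `C` compact. -/
abbrev fellTopology (X : Type*) [TopologicalSpace X] :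
    TopologicalSpace (TopologicalSpace.Closeds X) :=
  TopologicalSpace.generateFrom
    ({S | ∃ O : Set X, IsOpen O ∧ S = {A : TopologicalSpace.Closeds X | ((A : Set X) ∩ O).Nonempty}} ∪
     {S | ∃ C : Set X, IsCompact C ∧ S = {A : TopologicalSpace.Closeds X | (A : Set X) ⊆ Cᶜ}})

/-- The Gauss image `{(x, T_x W) | x ∈ W}`, as a subset of `U × Gr_d(E)`. -/
def gaussImage {d : ℕ} {U : TopologicalSpace.Opens E} (W : ProperSubmanifold d U) :
    Set (U × Gr E d) :=
  {z | (z.1 : E) ∈ W.carrier ∧ z.2.1 = tangentSpace W.carrier z.1}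

theorem isClosed_preimage_carrier {d : ℕ} {U : TopologicalSpace.Opens E}
    (W : ProperSubmanifold d U) : IsClosed {x : U | (x : E) ∈ W.carrier} := by
  rw [← isOpen_compl_iff, isOpen_iff_mem_nhds]
  intro x hx
  obtain ⟨K, hK, hxK, hKU⟩ := exists_compact_subset U.isOpen x.2
  have h1 : IsClosed (W.carrier ∩ K) := (W.proper K hK hKU).isClosed
  have h2 : interior K ∩ (W.carrier ∩ K)ᶜ ∈ 𝓝 (x : E) :=
    (isOpen_interior.inter h1.isOpen_compl).mem_nhds ⟨hxK, fun h => hx h.1⟩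
  filter_upwards [continuous_subtype_val.continuousAt.preimage_mem_nhds h2] with y hy hyW
  exact hy.2 ⟨hyW, interior_subset hy.1⟩

theorem isClosed_gaussImage {d : ℕ} {U : TopologicalSpace.Opens E}
    (W : ProperSubmanifold d U) : IsClosed (gaussImage W) := by
  rw [← isOpen_compl_iff, isOpen_iff_mem_nhds]
  rintro ⟨x, M⟩ hz
  by_cases hx : (x : E) ∈ W.carrier
  swap
  · have h1 := (isClosed_preimage_carrier W).isOpen_compl.mem_nhds (show x ∈ _ from hx)
    filter_upwards [continuous_fst.continuousAt.preimage_mem_nhds h1] with z hz' hzg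
    exact hz' hzg.1
  obtain ⟨Φ, L, hxs, h⟩ := W.isSubmanifold x hx
  obtain ⟨e, he, he'⟩ := h.exists_equiv hxs
  have hT := h.mem_tangentSpace hxs hx e he he'
  -- some vector of `M` is not tangent to `W` at `x`
  have hex : ∃ w ∈ M.1, e w ∉ L := by
    by_contra! hcon
    apply hz
    refine ⟨hx, ?_⟩
    have hle : M.1 ≤ tangentSpace W.carrier x := by
      rw [hT]; exact fun w hw => hcon w hw
    exact Submodule.eq_of_le_of_finrank_eq hle
      (by rw [M.2, finrank_tangentSpace W.isSubmanifold hx])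
  obtain ⟨w, hwM, hwL⟩ := hex
  have hcl : IsClosed (L : Set E) := L.closed_of_finiteDimensional
  have hc1 : ContinuousAt (fun z : U × Gr E d => fderiv ℝ Φ (z.1 : E)) (x, M) := by
    have hcf : ContinuousAt (fderiv ℝ Φ) (x : E) :=
      (h.contDiffOn.continuousOn_fderiv_of_isOpen Φ.open_source (by simp)).continuousAt
        (Φ.open_source.mem_nhds hxs)
    exact ContinuousAt.comp (f := fun z : U × Gr E d => (z.1 : E)) (x := (x, M)) hcf
      (by fun_prop)
  have hc2 : Continuous (fun L : Gr E d => L.1.starProjection) := continuous_induced_dom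
  have hc3 : ContinuousAt (fun z : U × Gr E d =>
      fderiv ℝ Φ (z.1 : E) (z.2.1.starProjection w)) (x, M) :=
    hc1.clm_apply ((hc2.comp continuous_snd).continuousAt.clm_apply continuousAt_const)
  have hev : ∀ᶠ z in 𝓝 (x, M), fderiv ℝ Φ (z.1 : E) (z.2.1.starProjection w) ∈
      (L : Set E)ᶜ := by
    refine hc3.eventually_mem (hcl.isOpen_compl.mem_nhds ?_)
    simp only [he.fderiv]
    rw [Submodule.starProjection_eq_self_iff.2 hwM]
    exact hwL
  have hsrc : ∀ᶠ z : U × Gr E d in 𝓝 (x, M), (z.1 : E) ∈ Φ.source :=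
    (continuous_subtype_val.comp continuous_fst).continuousAt.eventually_mem
      (Φ.open_source.mem_nhds hxs)
  filter_upwards [hev, hsrc] with z h1 h2 hzg
  apply h1
  obtain ⟨e2, he2, he2'⟩ := h.exists_equiv h2
  have hm : z.2.1.starProjection w ∈ tangentSpace W.carrier z.1 := by
    rw [← hzg.2]; exact Submodule.starProjection_apply_mem _ _
  rw [h.mem_tangentSpace h2 hzg.1 e2 he2 he2'] at hm
  rw [he2.fderiv]
  exact hm

/-- The map `Gauss : ψ_d(U) → CL(U × Gr_d(E))`. -/
def gauss {d : ℕ} {U : TopologicalSpace.Opens E} (W : ProperSubmanifold d U) :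
    TopologicalSpace.Closeds (U × Gr E d) :=
  ⟨gaussImage W, isClosed_gaussImage W⟩

/-- The differential Fell topology on `ψ_d(U)`: the Fell topology pulled back along `Gauss`. -/
noncomputable abbrev differentialFellTopology {d : ℕ} (U : TopologicalSpace.Opens E) :
    TopologicalSpace (ProperSubmanifold d U) :=
  TopologicalSpace.induced gauss (fellTopology (U × Gr E d))

/-! ### The normal bundle, its exponential map and its sections -/

/-- The normal bundle `NW`, as the set of pairs `(x, v)` with `x ∈ W` and `v ⟂ T_x W`. -/
def normalBundle (W : Set E) : Set (E × E) :=
  {z | z.1 ∈ W ∧ z.2 ∈ (tangentSpace W z.1)ᗮ}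

/-- The domain of the exponential map of the normal bundle of `W` in the flat manifold `U`: the
pairs `(x, v)` in `NW` such that the geodesic `t ↦ x + t v` stays in `U` for `0 ≤ t ≤ 1`. -/
def expDomain (U W : Set E) : Set (E × E) :=
  {z | z ∈ normalBundle W ∧ segment ℝ z.1 (z.1 + z.2) ⊆ U}

/-- The exponential map `exp_W (x, v) = x + v` (to be used on `expDomain U W`). -/
def normalExp (z : E × E) : E := z.1 + z.2

/-- `f` is a smooth section of `NW` over the subset `A` of `W` (with values off `A` ignored). -/
def IsSmoothSection (W A : Set E) (f : E → E) : Prop :=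
  ContDiffOn ℝ ∞ f A ∧ ∀ x ∈ A, (x, f x) ∈ normalBundle W

/-- The number `‖f(x)‖ + ‖τ ∘ (Df)(x)‖` for a section `f` of `NW` over an open subset `A` of `W`.
Here `τ ∘ (Df)(x) : T_x W → N_x W` is the vertical part of the differential, that is, the
orthogonal projection onto `N_x W` of the derivative of `f` along vectors tangent to `W`. It is
extended by zero to `N_x W` (by first projecting onto `T_x W`), which does not change its operator
norm. The derivative within `A` is determined on `T_x W = T_x A`. -/
noncomputable def sectionSize (W A : Set E) (f : E → E) (x : E) : ℝ :=
  ‖f x‖ + ‖(tangentSpace W x)ᗮ.starProjection ∘L fderivWithin ℝ f A x ∘L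
    (tangentSpace W x).starProjection‖

/-- The restriction `q : Q → W` of the projection of the normal bundle to a subset `Q ⊆ NW`. -/
def proj {W : Set E} {Q : Set (E × E)} (hQ : Q ⊆ normalBundle W) :
    Q → W :=
  fun z => ⟨z.1.1, (hQ z.2).1⟩

/-- `q : Q → W` is a local diffeomorphism: every point of `Q` has a neighbourhood in `Q` which `q`
maps bijectively onto an open subset `W ∩ V` of `W`, with smooth inverse `x ↦ (x, f x)`. -/
def IsLocalDiffeo (W : Set E) (Q : Set (E × E)) : Prop :=
  ∀ z ∈ Q, ∃ (O : Set (E × E)) (V : Set E) (f : E → E),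
    IsOpen O ∧ z ∈ O ∧ IsOpen V ∧ IsSmoothSection W (W ∩ V) f ∧
      Q ∩ O = (fun x => (x, f x)) '' (W ∩ V)

/-! ### The two topologies given by neighbourhood bases -/

/-- The basic neighbourhood `(K, ε)^gs` of `W`: the `W'` which, inside `K`, are the image of a
global section `f` of `NW` that is `C¹`-small over `K` (that is, at the `x ∈ W` for which `x` or
`exp_W (f x)` lies in `K`). -/
def gsNhd {d : ℕ} {U : TopologicalSpace.Opens E} (W : ProperSubmanifold d U)
    (K : Set E) (ε : ℝ) : Set (ProperSubmanifold d U) :=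
  {W' | ∃ f : E → E, IsSmoothSection W.carrier W.carrier f ∧
    (∀ x ∈ W.carrier, (x, f x) ∈ expDomain U W.carrier) ∧
    (fun x => normalExp (x, f x)) '' W.carrier ∩ K = W'.carrier ∩ K ∧
    ∀ x ∈ W.carrier, x ∈ K ∨ normalExp (x, f x) ∈ K → sectionSize W.carrier W.carrier f x < ε}

/-- The basic neighbourhood `(K, ε)^ls` of `W`: the `W'` for which there is a subset `Q` of `NW`
such that the projection `q : Q → W` hits every point of `W ∩ K`, is a local diffeomorphism and a
covering map (onto its image), `exp_W(Q) ∩ K = W' ∩ K`, and every local section of `q` is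
`C¹`-small. -/
def lsNhd {d : ℕ} {U : TopologicalSpace.Opens E} (W : ProperSubmanifold d U)
    (K : Set E) (ε : ℝ) : Set (ProperSubmanifold d U) :=
  {W' | ∃ (Q : Set (E × E)) (hQ : Q ⊆ normalBundle W.carrier),
    Q ⊆ expDomain U W.carrier ∧
    (∀ x ∈ W.carrier ∩ K, ∃ v, (x, v) ∈ Q) ∧
    IsLocalDiffeo W.carrier Q ∧
    IsCoveringMapOn (proj hQ) (range (proj hQ)) ∧
    normalExp '' Q ∩ K = W'.carrier ∩ K ∧
    ∀ (V : Set E) (f : E → E), IsOpen V →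
      IsSmoothSection W.carrier (W.carrier ∩ V) f →
      (∀ x ∈ W.carrier ∩ V, (x, f x) ∈ Q) →
      ∀ x ∈ W.carrier ∩ V, sectionSize W.carrier (W.carrier ∩ V) f x < ε}

theorem gsNhd_mono {d : ℕ} {U : TopologicalSpace.Opens E} (W : ProperSubmanifold d U)
    {K K' : Set E} (hK : K ⊆ K') {ε ε' : ℝ} (hε : ε' ≤ ε) :
    gsNhd W K' ε' ⊆ gsNhd W K ε := by
  rintro W' ⟨f, h1, h2, h3, h4⟩
  refine ⟨f, h1, h2, ?_, fun x hx hxK =>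
    (h4 x hx (hxK.imp (fun h => hK h) (fun h => hK h))).trans_le hε⟩
  rw [← inter_eq_self_of_subset_right hK, ← inter_assoc, ← inter_assoc, h3]

theorem lsNhd_mono {d : ℕ} {U : TopologicalSpace.Opens E} (W : ProperSubmanifold d U)
    {K K' : Set E} (hK : K ⊆ K') {ε ε' : ℝ} (hε : ε' ≤ ε) :
    lsNhd W K' ε' ⊆ lsNhd W K ε := by
  rintro W' ⟨Q, hQ, h0, h1, h2, h3, h4, h5⟩
  refine ⟨Q, hQ, h0, fun x hx => h1 x ⟨hx.1, hK hx.2⟩, h2, h3, ?_,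
    fun V f hV hf hfQ x hx => (h5 V f hV hf hfQ x hx).trans_le hε⟩
  rw [← inter_eq_self_of_subset_right hK, ← inter_assoc, ← inter_assoc, h4]

/-- The topology on `ψ_d(U)` given by basic neighbourhoods `B W K ε`, for `K ⊆ U` compact and
`0 < ε`: a set is open if with each of its elements `W` it contains some `B W K ε`. -/
abbrev topologyOfBasicNhds {d : ℕ} {U : TopologicalSpace.Opens E}
    (B : ProperSubmanifold d U → Set E → ℝ → Set (ProperSubmanifold d U))
    (mono : ∀ W {K K' : Set E}, K ⊆ K' → ∀ {ε ε' : ℝ}, ε' ≤ ε → B W K' ε' ⊆ B W K ε) :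
    TopologicalSpace (ProperSubmanifold d U) where
  IsOpen S := ∀ W ∈ S, ∃ K : Set E, IsCompact K ∧ K ⊆ U ∧ ∃ ε : ℝ, 0 < ε ∧ B W K ε ⊆ S
  isOpen_univ _ _ := ⟨∅, isCompact_empty, empty_subset _, 1, one_pos, subset_univ _⟩
  isOpen_inter S T hS hT := by
    rintro W ⟨h1, h2⟩
    obtain ⟨K, hK, hKU, ε, hε, h⟩ := hS W h1
    obtain ⟨K', hK', hKU', ε', hε', h'⟩ := hT W h2
    exact ⟨K ∪ K', hK.union hK', union_subset hKU hKU', min ε ε', lt_min hε hε',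
      subset_inter ((mono W subset_union_left (min_le_left _ _)).trans h)
        ((mono W subset_union_right (min_le_right _ _)).trans h')⟩
  isOpen_sUnion 𝒮 h𝒮 := by
    rintro W ⟨S, hS, hW⟩
    obtain ⟨K, hK, hKU, ε, hε, h⟩ := h𝒮 S hS W hW
    exact ⟨K, hK, hKU, ε, hε, h.trans (subset_sUnion_of_mem hS)⟩

/-- The (`C¹`) Galatius--Randal-Williams topology, i.e. the space `Ψ_d(U)`. -/
abbrev grwTopology {d : ℕ} (U : TopologicalSpace.Opens E) :
    TopologicalSpace (ProperSubmanifold d U) :=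
  topologyOfBasicNhds gsNhd gsNhd_mono

/-- The local sections topology, i.e. the space `Ψ̃_d(U)`. -/
abbrev lsTopology {d : ℕ} (U : TopologicalSpace.Opens E) :
    TopologicalSpace (ProperSubmanifold d U) :=
  topologyOfBasicNhds lsNhd lsNhd_mono

end

end SubmanifoldSpace

open SubmanifoldSpace

namespace SubmanifoldSpace

set_option linter.unusedSectionVars false

section

variable {E : Type*} [NormedAddCommGroup E] [InnerProductSpace ℝ E] [FiniteDimensional ℝ E]

/-! ### Orthogonal projections -/

/-! The link between the two descriptions is that, for a short normal section `f` of `W`, being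
`C¹`-small is the same as the displaced graph having tangent planes close to those of `W`. The
tangent plane of the graph is the image of `T_x W` under `id + Df`. The normal part of `Df` is what
`sectionSize` measures. The tangential part is bounded by `‖f‖` times a Lipschitz constant of `x ↦
T_x W`, because `f` stays normal. Both directions of the estimate are
`norm_starProjection_sub_le_of_sectionSize` and `sectionSize_le`.

Local sections refine Fell: each point of a `W'` in `(K, ε)^ls` inside `K` is a slightly displaced
point of `W` with nearly the same tangent plane, so `W'` keeps missing a compact set that `W`
misses. Since `Q` reaches every point of `W ∩ K`, `W'` also keeps hitting an open set that `W` hits.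

Fell refines local sections (`lsNhd_mem_nhds`): for `W'` close to `W`, let `Q` consist of the normal
vectors of length less than `δ`, based near `K`, that end on `W'`. Closeness of tangent planes makes
`W'` transverse to the normal spaces, so `Q → W` is a local diffeomorphism by the implicit function
theorem. Secants of `W` are nearly tangent, so vectors of length at most `δ` ending on `W'` are in
fact shorter than `δ/2`. Hence `Q` is closed over the region, and the projection is proper and a
covering onto its image. That image is open and closed in the region, so it contains each of
finitely many connected pieces covering `W ∩ K` as soon as `W'` comes near their centres.
Nearest-point projection to `W` shows that `Q` captures all of `W' ∩ K`.

A global section is a one-sheeted `Q`, so the Galatius--Randal-Williams topology is finer. It is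
strictly finer because two parallel planes merging into one converge in the Fell sense, whereas a
section meets each normal space of the limit only once. -/

theorem norm_sub_starProjection_le (S : Submodule ℝ E) (w : E) {u : E} (hu : u ∈ S) :
    ‖w - S.starProjection w‖ ≤ ‖w - u‖ := by
  have h : w - S.starProjection w = Sᗮ.starProjection (w - u) := by
    rw [Submodule.starProjection_orthogonal_val, map_sub,
      Submodule.starProjection_eq_self_iff.2 hu]
    abel
  rw [h]
  exact Submodule.norm_starProjection_apply_le _ _

/-- Write `P - Q = P(1 - Q) - (1 - P)Q`. The second term is small by the hypothesis on `T`. The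
first is the adjoint of `(1 - Q)P`, which is small by the hypothesis on `S`. -/
theorem norm_starProjection_sub_starProjection_le (S T : Submodule ℝ E) {a b : ℝ} (ha0 : 0 ≤ a)
    (hb0 : 0 ≤ b) (ha : ∀ u ∈ S, ‖u - T.starProjection u‖ ≤ a * ‖u‖)
    (hb : ∀ w ∈ T, ‖w - S.starProjection w‖ ≤ b * ‖w‖) :
    ‖S.starProjection - T.starProjection‖ ≤ a + b := by
  refine ContinuousLinearMap.opNorm_le_bound _ (add_nonneg ha0 hb0) fun x => ?_
  set P := S.starProjection with hP
  set Q := T.starProjection with hQ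
  have h1 : (P - Q) x = P (x - Q x) - (Q x - P (Q x)) := by
    simp only [map_sub, sub_apply]; abel
  have h2 : ‖Q x - P (Q x)‖ ≤ b * ‖x‖ :=
    (hb _ (Submodule.starProjection_apply_mem _ _)).trans
      (mul_le_mul_of_nonneg_left (Submodule.norm_starProjection_apply_le _ _) hb0)
  have h3 : ‖P (x - Q x)‖ ≤ a * ‖x‖ := by
    set y := P (x - Q x) with hy
    have hyS : y ∈ S := Submodule.starProjection_apply_mem _ _
    have e1 : inner ℝ y y = inner ℝ x (y - Q y) := by
      have s1 : inner ℝ y y = inner ℝ (x - Q x) y := by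
        have := Submodule.starProjection_isSymmetric S (x - Q x) y
        simp only [ContinuousLinearMap.coe_coe] at this
        rw [← hP, ← hy] at this
        rw [this, hP, Submodule.starProjection_eq_self_iff.2 hyS]
      have s2 : inner ℝ (Q x) y = inner ℝ x (Q y) :=
        Submodule.starProjection_isSymmetric T x y
      rw [s1, inner_sub_left, inner_sub_right, s2]
    have e2 : ‖y‖ * ‖y‖ ≤ (a * ‖x‖) * ‖y‖ := by
      rw [← real_inner_self_eq_norm_mul_norm, e1]
      calc inner ℝ x (y - Q y) ≤ ‖x‖ * ‖y - Q y‖ := real_inner_le_norm _ _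
        _ ≤ ‖x‖ * (a * ‖y‖) := mul_le_mul_of_nonneg_left (ha y hyS) (norm_nonneg _)
        _ = _ := by ring
    rcases (norm_nonneg y).eq_or_lt with h0 | h0
    · rw [← h0]; positivity
    · exact le_of_mul_le_mul_right e2 h0
  rw [h1, add_mul]
  exact (norm_sub_le _ _).trans (add_le_add h3 h2)

/-! ### Tangent spaces of submanifolds -/

variable {d : ℕ} {W : Set E}

/-- Straight lines in `L`, pulled back through a slice chart, already realise every tangent vector,
so the span in `tangentSpace` adds nothing. -/
theorem IsSubmanifold.exists_curve (hW : IsSubmanifold d W) {x : E} (hx : x ∈ W) {v : E}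
    (hv : v ∈ tangentSpace W x) :
    ∃ γ : ℝ → E, γ 0 = x ∧ (∀ᶠ t in 𝓝 0, γ t ∈ W) ∧ HasDerivAt γ v 0 := by
  obtain ⟨Φ, L, hxs, h⟩ := hW x hx
  obtain ⟨e, he, he'⟩ := h.exists_equiv hxs
  rw [h.mem_tangentSpace hxs hx e he he'] at hv
  have hv : e v ∈ L := hv
  have hxL : Φ x ∈ L := (h.mem_iff x hxs).1 hx
  refine ⟨fun t => Φ.symm (Φ x + t • e v), by simp [Φ.left_inv hxs], ?_, ?_⟩
  · have hc : ContinuousAt (fun t : ℝ => Φ x + t • e v) 0 := by fun_prop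
    filter_upwards [hc.eventually_mem
      (Φ.open_target.mem_nhds (by simpa using Φ.map_source hxs))] with t ht
    rw [h.mem_iff _ (Φ.map_target ht), Φ.right_inv ht]
    exact L.add_mem hxL (L.smul_mem _ hv)
  · have hl : HasDerivAt (fun t : ℝ => Φ x + t • e v) (e v) 0 := by
      simpa using ((hasDerivAt_id (0 : ℝ)).smul_const (e v)).const_add (Φ x)
    have he0 : HasFDerivAt Φ.symm (e.symm : E →L[ℝ] E) (Φ x + (0 : ℝ) • e v) := by
      simpa using he'
    have hd := he0.comp_hasDerivAt 0 hl
    have hev : (e.symm : E →L[ℝ] E) (e v) = v := e.symm_apply_apply v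
    rwa [hev] at hd

theorem mem_tangentSpace_of_curve {x : E} {γ : ℝ → E} {v : E} (h0 : γ 0 = x)
    (hγ : ∀ᶠ t in 𝓝 0, γ t ∈ W) (hv : HasDerivAt γ v 0) : v ∈ tangentSpace W x :=
  Submodule.subset_span ⟨γ, h0, hγ, hv⟩

/-- In a slice chart, the tangent space is parametrised by the derivative of the inverse chart. -/
theorem IsSliceChart.tangentSpace_fderiv {Φ : OpenPartialHomeomorph E E} {L : Submodule ℝ E}
    (h : IsSliceChart d W Φ L) {x : E} (hxs : x ∈ Φ.source) (hx : x ∈ W) :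
    (∀ v, fderiv ℝ Φ.symm (Φ x) (fderiv ℝ Φ x v) = v) ∧
    (∀ v, v ∈ tangentSpace W x ↔ fderiv ℝ Φ x v ∈ L) ∧
    (∀ l, fderiv ℝ Φ.symm (Φ x) l ∈ tangentSpace W x ↔ l ∈ L) := by
  obtain ⟨e, he, he'⟩ := h.exists_equiv hxs
  rw [he.fderiv, he'.fderiv, h.mem_tangentSpace hxs hx e he he']
  refine ⟨fun v => e.symm_apply_apply v, fun v => Iff.rfl, fun l => ?_⟩
  change e (e.symm l) ∈ L ↔ l ∈ L
  rw [e.apply_symm_apply]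

theorem IsSliceChart.continuousAt_fderiv {Φ : OpenPartialHomeomorph E E} {L : Submodule ℝ E}
    (h : IsSliceChart d W Φ L) {x : E} (hxs : x ∈ Φ.source) : ContinuousAt (fderiv ℝ Φ) x :=
  (h.contDiffOn.continuousOn_fderiv_of_isOpen Φ.open_source (by simp)).continuousAt
    (Φ.open_source.mem_nhds hxs)

theorem IsSliceChart.contDiffAt_fderiv_symm {Φ : OpenPartialHomeomorph E E} {L : Submodule ℝ E}
    (h : IsSliceChart d W Φ L) {x : E} (hxs : x ∈ Φ.source) :
    ContDiffAt ℝ ∞ (fun x => fderiv ℝ Φ.symm (Φ x)) x := by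
  have h1 : ContDiffAt ℝ ∞ (fderiv ℝ Φ.symm) (Φ x) :=
    (h.contDiffOn_symm.contDiffAt (Φ.open_target.mem_nhds (Φ.map_source hxs))).fderiv_right
      (m := ∞) (by simp)
  exact h1.comp x (h.contDiffOn.contDiffAt (Φ.open_source.mem_nhds hxs))

/-- The tangent plane at `x` is the image of the fixed space `L` under `D(Φ⁻¹)(Φ x)`, which is
locally Lipschitz in `x`. A vector of `T_x W` is compared with the vector of `T_x' W` that has the
same chart coordinates. The constant plays the role of a bound on the second fundamental form. -/
theorem IsSubmanifold.exists_lipschitz_starProjection (hW : IsSubmanifold d W) {x₀ : E}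
    (hx₀ : x₀ ∈ W) :
    ∃ C : ℝ, 0 ≤ C ∧ ∃ V ∈ 𝓝 x₀, ∀ x ∈ W ∩ V, ∀ x' ∈ W ∩ V,
      ‖(tangentSpace W x).starProjection - (tangentSpace W x').starProjection‖ ≤ C * ‖x - x'‖ := by
  obtain ⟨Φ, L, hxs, h⟩ := hW x₀ hx₀
  obtain ⟨k, V, hV, hk⟩ := ((h.contDiffAt_fderiv_symm hxs).of_le
    (m := 1) (by exact_mod_cast le_top)).exists_lipschitzOnWith
  have hM := (h.continuousAt_fderiv hxs).norm.eventually_lt_const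
    (lt_add_one ‖fderiv ℝ Φ x₀‖)
  set M := ‖fderiv ℝ Φ x₀‖ + 1
  have hM0 : 0 ≤ M := by positivity
  have key : ∀ x ∈ W ∩ (V ∩ ({x | ‖fderiv ℝ Φ x‖ < M} ∩ Φ.source)),
      ∀ x' ∈ W ∩ (V ∩ ({x | ‖fderiv ℝ Φ x‖ < M} ∩ Φ.source)), ∀ u ∈ tangentSpace W x,
      ‖u - (tangentSpace W x').starProjection u‖ ≤ (k * M * ‖x - x'‖) * ‖u‖ := by
    rintro x ⟨hxW, hxV, hxM, hxΦ⟩ x' ⟨hxW', hxV', hxM', hxΦ'⟩ u hu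
    obtain ⟨a1, a2, a3⟩ := h.tangentSpace_fderiv hxΦ hxW
    obtain ⟨b1, b2, b3⟩ := h.tangentSpace_fderiv hxΦ' hxW'
    set l := fderiv ℝ Φ x u with hl
    have hlL : l ∈ L := (a2 u).1 hu
    refine (norm_sub_starProjection_le _ u ((b3 l).2 hlL)).trans ?_
    have hlip := hk.dist_le_mul x hxV x' hxV'
    rw [dist_eq_norm, dist_eq_norm] at hlip
    calc ‖u - fderiv ℝ Φ.symm (Φ x') l‖
        = ‖(fderiv ℝ Φ.symm (Φ x) - fderiv ℝ Φ.symm (Φ x')) l‖ := by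
          rw [sub_apply, hl, a1]
      _ ≤ ‖fderiv ℝ Φ.symm (Φ x) - fderiv ℝ Φ.symm (Φ x')‖ * ‖l‖ :=
          ContinuousLinearMap.le_opNorm _ _
      _ ≤ (k * ‖x - x'‖) * (M * ‖u‖) := by
          gcongr
          exact (ContinuousLinearMap.le_opNorm _ _).trans
            (mul_le_mul_of_nonneg_right (le_of_lt hxM) (norm_nonneg _))
      _ = _ := by ring
  refine ⟨2 * (k * M), by positivity, _, inter_mem hV (inter_mem hM
    (Φ.open_source.mem_nhds hxs)), fun x hx x' hx' => ?_⟩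
  refine (norm_starProjection_sub_starProjection_le _ _ (by positivity) (by positivity)
    (key x hx x' hx') (key x' hx' x hx)).trans (le_of_eq ?_)
  rw [norm_sub_rev x' x]; ring

theorem IsSubmanifold.continuousOn_starProjection (hW : IsSubmanifold d W) :
    ContinuousOn (fun x => (tangentSpace W x).starProjection) W := by
  intro x hx
  obtain ⟨C, hC, V, hV, h⟩ := hW.exists_lipschitz_starProjection hx
  rw [ContinuousWithinAt, tendsto_iff_norm_sub_tendsto_zero]
  have h1 : Tendsto (fun y => C * ‖y - x‖) (𝓝[W] x) (𝓝 0) := by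
    have : Continuous fun y : E => C * ‖y - x‖ := by fun_prop
    simpa using (this.tendsto x).mono_left nhdsWithin_le_nhds
  refine squeeze_zero' (Eventually.of_forall fun _ => norm_nonneg _) ?_ h1
  filter_upwards [self_mem_nhdsWithin, mem_nhdsWithin_of_mem_nhds hV] with y hy hyV
  exact h y ⟨hy, hyV⟩ x ⟨hx, mem_of_mem_nhds hV⟩

theorem IsSubmanifold.exists_lipschitz_starProjection_compact (hW : IsSubmanifold d W) {K : Set E}
    (hK : IsCompact K) (hKW : K ⊆ W) :
    ∃ C : ℝ, 0 ≤ C ∧ ∀ x ∈ K, ∀ᶠ x' in 𝓝[W] x,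
      ‖(tangentSpace W x').starProjection - (tangentSpace W x).starProjection‖ ≤ C * ‖x' - x‖ := by
  choose! C hC V hV h using fun x (hx : x ∈ K) => hW.exists_lipschitz_starProjection (hKW hx)
  obtain ⟨t, ht, hcov⟩ := hK.elim_nhds_subcover (fun x => interior (V x))
    (fun x hx => interior_mem_nhds.2 (hV x hx))
  -- The sum of the finitely many nonnegative local constants dominates each of them.
  refine ⟨∑ y ∈ t, C y, Finset.sum_nonneg fun y hy => hC y (ht y hy), fun x hx => ?_⟩
  obtain ⟨y, hyt, hxy⟩ := mem_iUnion₂.1 (hcov hx)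
  filter_upwards [self_mem_nhdsWithin,
    mem_nhdsWithin_of_mem_nhds (isOpen_interior.mem_nhds hxy)] with x' hx' hxV'
  refine (h y (ht y hyt) x' ⟨hx', interior_subset hxV'⟩ x ⟨hKW hx, interior_subset hxy⟩).trans ?_
  gcongr
  exact Finset.single_le_sum (f := C) (fun z hz => hC z (ht z hz)) hyt

/-- Nearby secants of a submanifold are nearly tangent. -/
theorem IsSubmanifold.exists_nhds_secant (hW : IsSubmanifold d W) {x₀ : E} (hx₀ : x₀ ∈ W)
    {c : ℝ} (hc : 0 < c) :
    ∃ V ∈ 𝓝 x₀, ∀ x ∈ W ∩ V, ∀ x' ∈ W ∩ V,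
      ‖(x' - x) - (tangentSpace W x).starProjection (x' - x)‖ ≤ c * ‖x' - x‖ := by
  obtain ⟨Φ, L, hxs, h⟩ := hW x₀ hx₀
  obtain ⟨e, he, he'⟩ := h.exists_equiv hxs
  obtain ⟨k, V₁, hV₁, hk⟩ := ((h.contDiffOn.contDiffAt (Φ.open_source.mem_nhds hxs)).of_le
    (m := 1) (by exact_mod_cast le_top)).exists_lipschitzOnWith
  have hstrict : HasStrictFDerivAt Φ.symm (e.symm : E →L[ℝ] E) (Φ x₀) :=
    (h.contDiffOn_symm.contDiffAt (Φ.open_target.mem_nhds (Φ.map_source hxs))).hasStrictFDerivAt'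
      he' (by simp)
  -- Strict differentiability bounds the error by the distance in the chart, and passing back to `W`
  -- costs the Lipschitz constant `k` of `Φ`. The result is half of `c`; the other half pays for
  -- replacing `T_x₀ W` by `T_x W`.
  have hlo := hstrict.isLittleO.bound (c := c / (2 * (k + 1))) (by positivity)
  rw [nhds_prod_eq, eventually_prod_self_iff'] at hlo
  obtain ⟨A, hA, hAs⟩ := hlo
  have hA' : Φ ⁻¹' A ∈ 𝓝 x₀ := (Φ.continuousAt hxs).preimage_mem_nhds hA
  have hcont := (hW.continuousOn_starProjection x₀ hx₀)
  have hP : ∀ᶠ x in 𝓝[W] x₀, ‖(tangentSpace W x₀).starProjection -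
      (tangentSpace W x).starProjection‖ < c / 2 := by
    filter_upwards [hcont.eventually (Metric.ball_mem_nhds _ (half_pos hc))] with x hx
    rwa [← dist_eq_norm, dist_comm]
  rw [eventually_nhdsWithin_iff] at hP
  refine ⟨_, inter_mem hV₁ (inter_mem hA' (inter_mem hP (Φ.open_source.mem_nhds hxs))), ?_⟩
  rintro x ⟨hxW, hxV, hxA, hxP, hxΦ⟩ x' ⟨hxW', hxV', hxA', hxP', hxΦ'⟩
  set w := x' - x with hw
  have hL : Φ x' - Φ x ∈ L := L.sub_mem ((h.mem_iff _ hxΦ').1 hxW') ((h.mem_iff _ hxΦ).1 hxW)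
  have h1 : e.symm (Φ x' - Φ x) ∈ tangentSpace W x₀ := by
    have := (h.tangentSpace_fderiv hxs hx₀).2.2 (Φ x' - Φ x)
    rw [he'.fderiv] at this
    exact this.2 hL
  have h2 : ‖w - (tangentSpace W x₀).starProjection w‖ ≤ c / 2 * ‖w‖ := by
    refine (norm_sub_starProjection_le _ w h1).trans ?_
    have h3 := hAs (Φ x') hxA' (Φ x) hxA
    simp only [Φ.left_inv hxΦ, Φ.left_inv hxΦ'] at h3
    refine h3.trans ?_
    have hlip := hk.dist_le_mul x' hxV' x hxV
    rw [dist_eq_norm, dist_eq_norm] at hlip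
    calc c / (2 * (k + 1)) * ‖Φ x' - Φ x‖ ≤ c / (2 * (k + 1)) * ((k + 1) * ‖w‖) := by
          gcongr
          exact hlip.trans (by gcongr; simp)
      _ = c / 2 * ‖w‖ := by field_simp
  calc ‖w - (tangentSpace W x).starProjection w‖
      = ‖(w - (tangentSpace W x₀).starProjection w) + ((tangentSpace W x₀).starProjection -
        (tangentSpace W x).starProjection) w‖ := by rw [sub_apply]; congr 1; abel
    _ ≤ c / 2 * ‖w‖ + c / 2 * ‖w‖ := (norm_add_le _ _).trans (add_le_add h2
        ((ContinuousLinearMap.le_opNorm _ _).trans (by gcongr; exact (hxP hxW).le)))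
    _ = c * ‖w‖ := by ring

theorem IsSubmanifold.exists_secant_compact (hW : IsSubmanifold d W) {K : Set E}
    (hK : IsCompact K) (hKW : K ⊆ W) {c : ℝ} (hc : 0 < c) :
    ∃ δ > 0, ∀ x ∈ K, ∀ x' ∈ W, ‖x' - x‖ < δ →
      ‖(x' - x) - (tangentSpace W x).starProjection (x' - x)‖ ≤ c * ‖x' - x‖ := by
  choose! V hV h using fun x (hx : x ∈ K) => hW.exists_nhds_secant (hKW hx) hc
  obtain ⟨δ, hδ, hleb⟩ := lebesgue_number_lemma_of_metric (c := fun x : K => interior (V x)) hK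
    (fun x => isOpen_interior)
    (fun x hx => mem_iUnion.2 ⟨⟨x, hx⟩, mem_interior_iff_mem_nhds.2 (hV x hx)⟩)
  refine ⟨δ, hδ, fun x hx x' hx' hxx' => ?_⟩
  obtain ⟨y, hy⟩ := hleb x hx
  exact h y y.2 x ⟨hKW hx, interior_subset (hy (Metric.mem_ball_self hδ))⟩ x'
    ⟨hx', interior_subset (hy (by rwa [Metric.mem_ball, dist_eq_norm]))⟩

/-! ### Small sections of the normal bundle -/

theorem IsSmoothSection.hasFDerivWithinAt {A : Set E} {f : E → E} (hf : IsSmoothSection W A f)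
    {x : E} (hx : x ∈ A) : HasFDerivWithinAt f (fderivWithin ℝ f A x) A x :=
  ((hf.1 x hx).differentiableWithinAt (by simp)).hasFDerivWithinAt

theorem IsSmoothSection.mono {A B : Set E} {f : E → E} (hf : IsSmoothSection W A f) (h : B ⊆ A) :
    IsSmoothSection W B f :=
  ⟨hf.1.mono h, fun x hx => hf.2 x (h hx)⟩

theorem IsSubmanifold.exists_curve_section (hW : IsSubmanifold d W) {V : Set E} (hV : IsOpen V)
    {f : E → E} (hf : IsSmoothSection W (W ∩ V) f) {x : E} (hx : x ∈ W ∩ V) {u : E}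
    (hu : u ∈ tangentSpace W x) :
    ∃ γ : ℝ → E, γ 0 = x ∧ (∀ᶠ t in 𝓝 0, γ t ∈ W ∩ V) ∧ HasDerivAt γ u 0 ∧
      HasDerivAt (fun t => f (γ t)) (fderivWithin ℝ f (W ∩ V) x u) 0 := by
  obtain ⟨γ, h0, hγ, hd⟩ := hW.exists_curve hx.1 hu
  have hγ' : ∀ᶠ t in 𝓝 0, γ t ∈ W ∩ V := by
    filter_upwards [hγ, hd.continuousAt.eventually_mem (hV.mem_nhds (by rw [h0]; exact hx.2))]
      with t h1 h2 using ⟨h1, h2⟩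
  refine ⟨γ, h0, hγ', hd, ?_⟩
  have h1 : HasFDerivWithinAt f (fderivWithin ℝ f (W ∩ V) x) (W ∩ V) (γ 0) := by
    rw [h0]; exact hf.hasFDerivWithinAt hx
  exact h1.comp_hasDerivAt 0 hd hγ'

/-- The derivative of `x ↦ x + f x` maps the tangent space of `W` to that of `W'`, if `f` is a
local section of the normal bundle of `W` whose displaced graph lies in `W'`. -/
theorem IsSubmanifold.add_fderivWithin_mem_tangentSpace (hW : IsSubmanifold d W) {W' : Set E}
    {V : Set E} (hV : IsOpen V) {f : E → E} (hf : IsSmoothSection W (W ∩ V) f) {x : E}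
    (hx : x ∈ W ∩ V) (hfW' : ∀ᶠ x' in 𝓝[W ∩ V] x, x' + f x' ∈ W') {u : E}
    (hu : u ∈ tangentSpace W x) :
    u + fderivWithin ℝ f (W ∩ V) x u ∈ tangentSpace W' (x + f x) := by
  obtain ⟨γ, h0, hγ, hd, hd'⟩ := hW.exists_curve_section hV hf hx hu
  refine mem_tangentSpace_of_curve (γ := fun t => γ t + f (γ t)) (by simp [h0]) ?_ (hd.add hd')
  have h1 : Tendsto γ (𝓝 0) (𝓝[W ∩ V] x) :=
    tendsto_nhdsWithin_iff.2 ⟨by simpa [h0] using hd.continuousAt.tendsto, hγ⟩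
  exact h1.eventually hfW'

/-- The tangential part of the derivative of a normal section is controlled by the section. -/
theorem IsSubmanifold.norm_starProjection_fderivWithin_le (hW : IsSubmanifold d W)
    {V : Set E} (hV : IsOpen V) {f : E → E} (hf : IsSmoothSection W (W ∩ V) f) {x : E}
    (hx : x ∈ W ∩ V) {C : ℝ} (hC : ∀ᶠ x' in 𝓝[W] x,
      ‖(tangentSpace W x').starProjection - (tangentSpace W x).starProjection‖ ≤ C * ‖x' - x‖)
    {u : E} (hu : u ∈ tangentSpace W x) :
    ‖(tangentSpace W x).starProjection (fderivWithin ℝ f (W ∩ V) x u)‖ ≤ C * ‖u‖ * ‖f x‖ := by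
  obtain ⟨γ, h0, hγ, hd, hd'⟩ := hW.exists_curve_section hV hf hx hu
  have hP : ∀ x' ∈ W ∩ V, (tangentSpace W x').starProjection (f x') = 0 := fun x' hx' =>
    (Submodule.starProjection_apply_eq_zero_iff _).2 (hf.2 x' hx').2
  have h1 : HasDerivAt (fun t => (tangentSpace W x).starProjection (f (γ t)))
      ((tangentSpace W x).starProjection (fderivWithin ℝ f (W ∩ V) x u)) 0 :=
    (tangentSpace W x).starProjection.hasFDerivAt.comp_hasDerivAt 0 hd'
  have t1 := h1.tendsto_slope_zero.norm
  have t2 := ((hd.tendsto_slope_zero.norm).const_mul C).mul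
    ((hd'.continuousAt.tendsto.mono_left (nhdsWithin_le_nhds (s := {0}ᶜ))).norm)
  simp only [h0] at t2
  refine le_of_tendsto_of_tendsto t1 t2 ?_
  have hW' : Tendsto γ (𝓝 0) (𝓝[W] x) :=
    tendsto_nhdsWithin_iff.2 ⟨by simpa [h0] using hd.continuousAt.tendsto,
      hγ.mono fun t ht => ht.1⟩
  filter_upwards [nhdsWithin_le_nhds hγ, nhdsWithin_le_nhds (hW'.eventually hC)] with t ht1 ht2
  simp only [zero_add, h0, hP x hx, sub_zero, norm_smul]
  -- Since `f (γ t)` is normal at `γ t`, its projection to `T_x W` only sees the change of tangent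
  -- plane between `x` and `γ t`.
  have h3 : ‖(tangentSpace W x).starProjection (f (γ t))‖ ≤ C * ‖γ t - x‖ * ‖f (γ t)‖ := by
    have : (tangentSpace W x).starProjection (f (γ t)) = -(((tangentSpace W (γ t)).starProjection -
        (tangentSpace W x).starProjection) (f (γ t))) := by
      rw [sub_apply, hP _ ht1]; simp
    rw [this, norm_neg]
    exact (ContinuousLinearMap.le_opNorm _ _).trans (by gcongr)
  calc ‖t⁻¹‖ * ‖(tangentSpace W x).starProjection (f (γ t))‖
      ≤ ‖t⁻¹‖ * (C * ‖γ t - x‖ * ‖f (γ t)‖) := by gcongr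
    _ = _ := by ring

theorem norm_le_sectionSize (A : Set E) (f : E → E) (x : E) : ‖f x‖ ≤ sectionSize W A f x :=
  le_add_of_nonneg_right (norm_nonneg _)

theorem norm_normal_fderivWithin_le_sectionSize (A : Set E) (f : E → E) (x : E) {u : E}
    (hu : u ∈ tangentSpace W x) :
    ‖fderivWithin ℝ f A x u - (tangentSpace W x).starProjection (fderivWithin ℝ f A x u)‖ ≤
      sectionSize W A f x * ‖u‖ := by
  have h := ContinuousLinearMap.le_opNorm ((tangentSpace W x)ᗮ.starProjection ∘L
    fderivWithin ℝ f A x ∘L (tangentSpace W x).starProjection) u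
  simp only [ContinuousLinearMap.comp_apply, Submodule.starProjection_eq_self_iff.2 hu,
    Submodule.starProjection_orthogonal_val] at h
  refine h.trans ?_
  gcongr
  exact le_add_of_nonneg_left (norm_nonneg _)

/-- If a normal section of `W` is `C¹`-small at `x`, then the tangent space of its displaced graph
is close to the tangent space of `W`. -/
theorem IsSubmanifold.norm_starProjection_sub_le_of_sectionSize (hW : IsSubmanifold d W)
    {W' : Set E} (hW' : IsSubmanifold d W')
    {V : Set E} (hV : IsOpen V) {f : E → E} (hf : IsSmoothSection W (W ∩ V) f) {x : E}
    (hx : x ∈ W ∩ V) {C : ℝ} (hC0 : 0 ≤ C) (hC : ∀ᶠ x' in 𝓝[W] x,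
      ‖(tangentSpace W x').starProjection - (tangentSpace W x).starProjection‖ ≤ C * ‖x' - x‖)
    (hfW' : ∀ᶠ x' in 𝓝[W ∩ V] x, x' + f x' ∈ W') (hxW' : x + f x ∈ W')
    {ε : ℝ} (hε : sectionSize W (W ∩ V) f x ≤ ε) (hε' : (C + 1) * ε ≤ 1 / 2) :
    ‖(tangentSpace W' (x + f x)).starProjection - (tangentSpace W x).starProjection‖ ≤
      3 * ((C + 1) * ε) := by
  set D := fderivWithin ℝ f (W ∩ V) x with hD
  set κ := (C + 1) * ε with hκ
  have hε0 : 0 ≤ ε := (add_nonneg (norm_nonneg _) (norm_nonneg _)).trans hε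
  have hκ0 : 0 ≤ κ := by positivity
  -- The tangential part of `D` contributes `C * ε` and the normal part `ε`.
  have hDu : ∀ u ∈ tangentSpace W x, ‖D u‖ ≤ κ * ‖u‖ := by
    intro u hu
    have h1 := hW.norm_starProjection_fderivWithin_le hV hf hx hC hu
    have h2 := norm_normal_fderivWithin_le_sectionSize (W ∩ V) f x hu
    have h3 : ‖f x‖ ≤ ε := (norm_le_sectionSize _ _ _).trans hε
    calc ‖D u‖ = ‖(tangentSpace W x).starProjection (D u) +
          (D u - (tangentSpace W x).starProjection (D u))‖ := by congr 1; abel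
      _ ≤ C * ‖u‖ * ‖f x‖ + sectionSize W (W ∩ V) f x * ‖u‖ :=
          (norm_add_le _ _).trans (add_le_add h1 h2)
      _ ≤ C * ‖u‖ * ε + ε * ‖u‖ := by gcongr
      _ = κ * ‖u‖ := by rw [hκ]; ring
  have hlow : ∀ u ∈ tangentSpace W x, ‖u‖ ≤ 2 * ‖u + D u‖ := by
    intro u hu
    have h1 := hDu u hu
    have h2 : ‖u‖ ≤ ‖u + D u‖ + ‖D u‖ := by
      simpa using norm_sub_le (u + D u) (D u)
    nlinarith [norm_nonneg u]
  -- The map `id + D` is injective by `hlow`, and both tangent spaces have dimension `d`. So every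
  -- tangent vector of `W'` has the form `u + D u`, which gives the estimate in the other direction.
  set g : tangentSpace W x →ₗ[ℝ] tangentSpace W' (x + f x) :=
    LinearMap.codRestrict _ ((LinearMap.id + (D : E →ₗ[ℝ] E)) ∘ₗ (tangentSpace W x).subtype)
      (fun u => hW.add_fderivWithin_mem_tangentSpace hV hf hx hfW' u.2) with hg
  have hginj : Function.Injective g := by
    rw [← LinearMap.ker_eq_bot, LinearMap.ker_eq_bot']
    intro u hu
    have h1 : (u : E) + D u = 0 := congrArg Subtype.val hu
    have h2 := hlow u u.2
    rw [h1] at h2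
    simpa using h2
  have hgsurj : Function.Surjective g := by
    refine (LinearMap.injective_iff_surjective_of_finrank_eq_finrank ?_).1 hginj
    rw [finrank_tangentSpace hW hx.1, finrank_tangentSpace hW' hxW']
  rw [norm_sub_rev]
  refine (norm_starProjection_sub_starProjection_le _ _ hκ0 (b := 2 * κ) (by positivity) ?_
    ?_).trans (le_of_eq (by ring))
  · intro u hu
    refine (norm_sub_starProjection_le _ u
      (hW.add_fderivWithin_mem_tangentSpace hV hf hx hfW' hu)).trans ?_
    simpa using hDu u hu
  · intro w hw
    obtain ⟨u, hu⟩ := hgsurj ⟨w, hw⟩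
    have hu' : (u : E) + D u = w := congrArg Subtype.val hu
    refine (norm_sub_starProjection_le _ w u.2).trans ?_
    rw [← hu', add_sub_cancel_left]
    calc ‖D u‖ ≤ κ * ‖(u : E)‖ := hDu u u.2
      _ ≤ κ * (2 * ‖(u : E) + D u‖) := by gcongr; exact hlow u u.2
      _ = _ := by ring

/-- Conversely, a normal section of `W` is `C¹`-small at `x` if its value is small and its
displaced graph has tangent space close to that of `W`. -/
theorem IsSubmanifold.sectionSize_le (hW : IsSubmanifold d W) {W' : Set E}
    {V : Set E} (hV : IsOpen V) {f : E → E} (hf : IsSmoothSection W (W ∩ V) f) {x : E}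
    (hx : x ∈ W ∩ V) {C : ℝ} (hC : ∀ᶠ x' in 𝓝[W] x,
      ‖(tangentSpace W x').starProjection - (tangentSpace W x).starProjection‖ ≤ C * ‖x' - x‖)
    (hfW' : ∀ᶠ x' in 𝓝[W ∩ V] x, x' + f x' ∈ W') (hCf : C * ‖f x‖ ≤ 1) {η : ℝ} (hη : η ≤ 1 / 2)
    (hT : ‖(tangentSpace W' (x + f x)).starProjection - (tangentSpace W x).starProjection‖ ≤ η) :
    sectionSize W (W ∩ V) f x ≤ ‖f x‖ + 4 * η := by
  have hη0 : 0 ≤ η := (norm_nonneg _).trans hT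
  refine add_le_add le_rfl (ContinuousLinearMap.opNorm_le_bound _ (by positivity) fun z => ?_)
  set D := fderivWithin ℝ f (W ∩ V) x with hD
  set P := (tangentSpace W x).starProjection with hP
  have hu : P z ∈ tangentSpace W x := Submodule.starProjection_apply_mem _ _
  set u := P z
  have huz : ‖u‖ ≤ ‖z‖ := Submodule.norm_starProjection_apply_le _ _
  simp only [ContinuousLinearMap.comp_apply, Submodule.starProjection_orthogonal_val]
  have h1 : ‖P (D u)‖ ≤ ‖u‖ := by
    refine (hW.norm_starProjection_fderivWithin_le hV hf hx hC hu).trans ?_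
    nlinarith [norm_nonneg u]
  have hPu : P u = u := Submodule.starProjection_eq_self_iff.2 hu
  have hw := hW.add_fderivWithin_mem_tangentSpace hV hf hx hfW' hu
  set w := u + D u with hwdef
  have h2 : ‖w - P w‖ ≤ η * ‖w‖ := by
    have e1 : w - P w = ((tangentSpace W' (x + f x)).starProjection - P) w := by
      rw [sub_apply, Submodule.starProjection_eq_self_iff.2 hw]
    rw [e1]
    exact (ContinuousLinearMap.le_opNorm _ _).trans (by gcongr)
  have e2 : w - P w = D u - P (D u) := by rw [hwdef, map_add, hPu]; abel
  have h3 : ‖w‖ ≤ 2 * ‖u‖ + ‖w - P w‖ := by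
    have : w = (u + P (D u)) + (w - P w) := by rw [e2]; simp only [hwdef]; abel
    calc ‖w‖ = ‖(u + P (D u)) + (w - P w)‖ := by rw [← this]
      _ ≤ _ := norm_add_le _ _
      _ ≤ _ := by
        gcongr
        exact (norm_add_le _ _).trans (by linarith)
  rw [e2] at h2 h3
  change ‖D u - P (D u)‖ ≤ _
  -- With `a` the norm of the normal part, `a ≤ η * (2 * ‖u‖ + a)`. As `η ≤ 1/2`, the last term is
  -- absorbed, and `2 * η` becomes `4 * η`.
  nlinarith [norm_nonneg u, norm_nonneg w, norm_nonneg (D u - P (D u))]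

end

section

/-! ### Smooth implicit functions -/

/-- Apply the inverse function theorem to `G (x, v) = (x, F (x, v))`; the implicit function is the
second component of the inverse along `(x, 0)`. The last clause, uniqueness of the zero in `O` over
each base point, is what later identifies a sheet of a multisection with a graph. -/
theorem exists_smooth_implicitFunction {E H : Type*} [NormedAddCommGroup E] [NormedSpace ℝ E]
    [FiniteDimensional ℝ E] [NormedAddCommGroup H] [NormedSpace ℝ H] [FiniteDimensional ℝ H]
    (hdim : Module.finrank ℝ E = Module.finrank ℝ H) {F : E × E → H} {S : Set (E × E)}
    (hS : IsOpen S) (hF : ContDiffOn ℝ ∞ F S) {z : E × E} (hz : z ∈ S)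
    {F₂ : E →L[ℝ] H} (hF₂ : HasFDerivAt (fun v => F (z.1, v)) F₂ z.2)
    (hinj : Function.Injective F₂) :
    ∃ (O : Set (E × E)) (V : Set E) (f : E → E), IsOpen O ∧ (F z = 0 → z ∈ O) ∧ O ⊆ S ∧ IsOpen V ∧
      ContDiffOn ℝ ∞ f V ∧ (∀ x ∈ V, (x, f x) ∈ O ∧ F (x, f x) = 0) ∧
      ∀ y ∈ O, F y = 0 → y.1 ∈ V ∧ f y.1 = y.2 := by
  have : CompleteSpace E := FiniteDimensional.complete ℝ E
  have : CompleteSpace H := FiniteDimensional.complete ℝ H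
  set G : E × E → E × H := fun y => (y.1, F y) with hG
  have hGS : ContDiffOn ℝ ∞ G S := contDiff_fst.contDiffOn.prodMk hF
  have hFz : HasFDerivAt F (fderiv ℝ F z) z :=
    ((hF.contDiffAt (hS.mem_nhds hz)).differentiableAt (by simp)).hasFDerivAt
  have hF' : ∀ w, fderiv ℝ F z (0, w) = F₂ w := by
    have h1 : HasFDerivAt (fun v : E => (z.1, v)) (ContinuousLinearMap.inr ℝ E E) z.2 :=
      hasFDerivAt_prodMk_right z.1 z.2
    have h2 := HasFDerivAt.comp (g := F) z.2 (show HasFDerivAt F (fderiv ℝ F z) (z.1, z.2) from hFz)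
      h1
    intro w
    rw [hF₂.unique h2]
    simp
  have hGz : HasFDerivAt G ((ContinuousLinearMap.fst ℝ E E).prod (fderiv ℝ F z)) z :=
    hasFDerivAt_fst.prodMk hFz
  set D := (ContinuousLinearMap.fst ℝ E E).prod (fderiv ℝ F z) with hD
  have hDinj : Function.Injective D := by
    refine (injective_iff_map_eq_zero D).2 ?_
    rintro ⟨u, w⟩ huw
    have h1 : u = 0 := congrArg Prod.fst huw
    have h2 : fderiv ℝ F z (u, w) = 0 := congrArg Prod.snd huw
    rw [h1, hF'] at h2
    rw [h1, (injective_iff_map_eq_zero F₂).1 hinj w h2]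
    rfl
  set e : (E × E) ≃L[ℝ] E × H := (LinearEquiv.ofInjectiveOfFinrankEq (D : E × E →ₗ[ℝ] E × H) hDinj
    (by simp [hdim])).toContinuousLinearEquiv with he
  have heD : (e : E × E →L[ℝ] E × H) = D := by ext <;> rfl
  have hGz' : HasFDerivAt G (e : E × E →L[ℝ] E × H) z := by rw [heD]; exact hGz
  have hGat : ContDiffAt ℝ ∞ G z := hGS.contDiffAt (hS.mem_nhds hz)
  -- The inverse has to be smooth on the whole target and not just at `G z`, so the chart is
  -- restricted to points where `DG` is invertible.
  have hinv : ∀ᶠ y in 𝓝 z, fderiv ℝ G y ∈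
      range ((↑) : ((E × E) ≃L[ℝ] E × H) → (E × E →L[ℝ] E × H)) := by
    have hc : ContinuousAt (fderiv ℝ G) z :=
      (hGS.continuousOn_fderiv_of_isOpen hS (by simp)).continuousAt (hS.mem_nhds hz)
    refine hc.eventually_mem ?_
    rw [hGz'.fderiv]
    exact ContinuousLinearEquiv.nhds e
  obtain ⟨T, hT, hTo, hzT⟩ := mem_nhds_iff.1 (inter_mem hinv (hS.mem_nhds hz))
  set φ := (hGat.toOpenPartialHomeomorph G hGz' (by simp)).restrOpen T hTo with hφ
  have hφG : ∀ y, φ y = G y := fun y => rfl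
  have hφs : φ.source ⊆ T := inter_subset_right
  have hφsymm : ∀ p ∈ φ.target, ContDiffAt ℝ ∞ φ.symm p := by
    intro p hp
    have h1 := hT (hφs (φ.map_target hp))
    obtain ⟨e', he'⟩ := h1.1
    have h3 : ContDiffAt ℝ ∞ G (φ.symm p) := hGS.contDiffAt (hS.mem_nhds h1.2)
    refine φ.contDiffAt_symm (f₀' := e') hp ?_ h3
    rw [he']
    exact (h3.differentiableAt (by simp)).hasFDerivAt
  have hcont : Continuous (fun x : E => (x, (0 : H))) := by fun_prop
  refine ⟨φ.source, (fun x : E => (x, (0 : H))) ⁻¹' φ.target, fun x => (φ.symm (x, 0)).2,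
    φ.open_source, fun _ => ⟨hGat.mem_toOpenPartialHomeomorph_source hGz' (by simp), hzT⟩,
    fun y hy => (hT (hφs hy)).2, φ.open_target.preimage hcont, ?_, ?_, ?_⟩
  · intro x hx
    have h1 : ContDiffAt ℝ ∞ (fun x : E => φ.symm (x, (0 : H))) x :=
      (hφsymm _ hx).comp x (contDiffAt_id.prodMk contDiffAt_const)
    exact (contDiffAt_snd.comp x h1).contDiffWithinAt
  · intro x hx
    have h1 : G (φ.symm (x, 0)) = (x, 0) := φ.right_inv hx
    have h2 : (φ.symm (x, 0)).1 = x := congrArg Prod.fst h1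
    have h3 : (x, (φ.symm (x, 0)).2) = φ.symm (x, 0) := Prod.ext h2.symm rfl
    rw [h3]
    exact ⟨φ.map_target hx, congrArg Prod.snd h1⟩
  · intro y hy hFy
    have h1 : φ y = (y.1, 0) := by rw [hφG, hG, ← hFy]
    refine ⟨?_, ?_⟩
    · change (y.1, 0) ∈ φ.target
      rw [← h1]; exact φ.map_source hy
    · change (φ.symm (y.1, 0)).2 = y.2
      rw [← h1, φ.left_inv hy]

end

section

variable {E : Type*} [NormedAddCommGroup E] [InnerProductSpace ℝ E] [FiniteDimensional ℝ E]
variable {d : ℕ} {W : Set E}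

/-- If `W'` is transverse to the normal space of `W` at `x₀`, then near `x₀ + v₀` it is the
displaced graph of a smooth normal section of `W`. -/
theorem IsSubmanifold.exists_section (hW : IsSubmanifold d W) {W' : Set E}
    (hW' : IsSubmanifold d W') {z : E × E} (hz : z ∈ normalBundle W) (hz' : z.1 + z.2 ∈ W')
    (htrans : ∀ w ∈ tangentSpace W' (z.1 + z.2), w ∈ (tangentSpace W z.1)ᗮ → w = 0) :
    ∃ (O : Set (E × E)) (V : Set E) (f : E → E), IsOpen O ∧ z ∈ O ∧ IsOpen V ∧
      ContDiffOn ℝ ∞ f V ∧ (∀ x ∈ V, (x, f x) ∈ O) ∧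
      (∀ x ∈ W ∩ V, (x, f x) ∈ normalBundle W ∧ x + f x ∈ W') ∧
      ∀ y ∈ O, y ∈ normalBundle W → y.1 + y.2 ∈ W' → y.1 ∈ V ∧ f y.1 = y.2 := by
  obtain ⟨Φ, L, hΦ, h⟩ := hW z.1 hz.1
  obtain ⟨Φ', L', hΦ', h'⟩ := hW' _ hz'
  set b := Module.finBasisOfFinrankEq ℝ L h.finrank_eq
  set B : E → E →L[ℝ] E := fun x => fderiv ℝ Φ.symm (Φ x) with hB
  -- The first component says that `v` is orthogonal to a smooth frame of `T_x W`, the second that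
  -- `x + v` lies in `W'`. Both formulas also make sense for `x` off `W`, so the implicit function
  -- theorem can be used in the ambient space.
  set F : E × E → (Fin d → ℝ) × L'ᗮ := fun y =>
    (fun i => inner ℝ (B y.1 (b i)) y.2, L'ᗮ.orthogonalProjectionOnto (Φ' (y.1 + y.2))) with hF
  set S : Set (E × E) := Prod.fst ⁻¹' Φ.source ∩ (fun y => y.1 + y.2) ⁻¹' Φ'.source with hS
  have hSo : IsOpen S := (Φ.open_source.preimage continuous_fst).inter
    (Φ'.open_source.preimage (continuous_fst.add continuous_snd))
  have hFS : ContDiffOn ℝ ∞ F S := by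
    intro y hy
    refine ContDiffAt.contDiffWithinAt (ContDiffAt.prodMk ?_ ?_)
    · refine contDiffAt_pi.2 fun i => ContDiffAt.inner ℝ ?_ contDiffAt_snd
      have h1 : ContDiffAt ℝ ∞ (fun y : E × E => B y.1) y :=
        (h.contDiffAt_fderiv_symm hy.1).comp y contDiffAt_fst
      exact h1.clm_apply contDiffAt_const
    · have h1 : ContDiffAt ℝ ∞ Φ' (y.1 + y.2) :=
        h'.contDiffOn.contDiffAt (Φ'.open_source.mem_nhds hy.2)
      exact (L'ᗮ.orthogonalProjectionOnto).contDiff.contDiffAt.comp y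
        (h1.comp y (contDiffAt_fst.add contDiffAt_snd))
  have hN : ∀ x ∈ W ∩ Φ.source, ∀ v, v ∈ (tangentSpace W x)ᗮ ↔
      (fun i => inner ℝ (B x (b i)) v) = 0 := by
    rintro x ⟨hx, hxs⟩ v
    obtain ⟨a1, a2, a3⟩ := h.tangentSpace_fderiv hxs hx
    constructor
    · intro hv
      funext i
      exact hv _ ((a3 _).2 (b i).2)
    · intro hv u hu
      have hlin : ((innerₗ E).flip v ∘ₗ (B x : E →ₗ[ℝ] E) ∘ₗ L.subtype) = 0 :=
        b.ext fun i => congrFun hv i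
      have := LinearMap.congr_fun hlin ⟨fderiv ℝ Φ x u, (a2 u).1 hu⟩
      have h3 : inner ℝ (fderiv ℝ Φ.symm (Φ x) (fderiv ℝ Φ x u)) v = 0 := this
      rwa [a1] at h3
  have hFW : ∀ y ∈ S, y.1 ∈ W → (F y = 0 ↔ y ∈ normalBundle W ∧ y.1 + y.2 ∈ W') := by
    intro y hy hyW
    rw [hF, Prod.mk_eq_zero, ← hN y.1 ⟨hyW, hy.1⟩, Submodule.orthogonalProjectionOnto_eq_zero_iff,
      Submodule.orthogonal_orthogonal, h'.mem_iff _ hy.2]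
    exact and_congr ⟨fun hh => ⟨hyW, hh⟩, fun hh => hh.2⟩ Iff.rfl
  have hzS : z ∈ S := ⟨hΦ, hΦ'⟩
  set F₂ : E →L[ℝ] (Fin d → ℝ) × L'ᗮ :=
    (ContinuousLinearMap.pi fun i => innerSL ℝ (B z.1 (b i))).prod
      (L'ᗮ.orthogonalProjectionOnto ∘L fderiv ℝ Φ' (z.1 + z.2)) with hF₂
  have hderiv : HasFDerivAt (fun v => F (z.1, v)) F₂ z.2 := by
    refine HasFDerivAt.prodMk (hasFDerivAt_pi.2 fun i => ?_) ?_
    · exact (innerSL ℝ (B z.1 (b i))).hasFDerivAt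
    · have h1 : HasFDerivAt Φ' (fderiv ℝ Φ' (z.1 + z.2)) (z.1 + z.2) :=
        ((h'.contDiffOn.contDiffAt (Φ'.open_source.mem_nhds hΦ')).differentiableAt
          (by simp)).hasFDerivAt
      have h2 : HasFDerivAt (fun v : E => z.1 + v) (ContinuousLinearMap.id ℝ E) z.2 :=
        (hasFDerivAt_id _).const_add _
      exact (L'ᗮ.orthogonalProjectionOnto).hasFDerivAt.comp z.2 (h1.comp z.2 h2)
  have hinj : Function.Injective F₂ := by
    refine (injective_iff_map_eq_zero F₂).2 fun w hw => ?_
    have h1 : (fun i => inner ℝ (B z.1 (b i)) w) = 0 := congrArg Prod.fst hw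
    have h2 : L'ᗮ.orthogonalProjectionOnto (fderiv ℝ Φ' (z.1 + z.2) w) = 0 := congrArg Prod.snd hw
    rw [Submodule.orthogonalProjectionOnto_eq_zero_iff, Submodule.orthogonal_orthogonal] at h2
    exact htrans w (((h'.tangentSpace_fderiv hΦ' hz').2.1 w).2 h2) ((hN z.1 ⟨hz.1, hΦ⟩ w).2 h1)
  have hdim : Module.finrank ℝ E = Module.finrank ℝ ((Fin d → ℝ) × L'ᗮ) := by
    rw [Module.finrank_prod, Module.finrank_fin_fun, ← h'.finrank_eq,
      Submodule.finrank_add_finrank_orthogonal]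
  obtain ⟨O, V, f, hO, hzO, hOS, hV, hf, hVO, hOV⟩ :=
    exists_smooth_implicitFunction hdim hSo hFS hzS hderiv hinj
  refine ⟨O, V, f, hO, hzO ((hFW z hzS hz.1).2 ⟨hz, hz'⟩), hV, hf, fun x hx => (hVO x hx).1, ?_, ?_⟩
  · rintro x ⟨hxW, hxV⟩
    exact (hFW _ (hOS (hVO x hxV).1) hxW).1 (hVO x hxV).2
  · intro y hy hyN hyW'
    exact hOV y hy ((hFW y (hOS hy) hyN.1).2 ⟨hyN, hyW'⟩)

/-! ### Covering maps -/

theorem IsLocalDiffeo.isLocalHomeomorph {Q : Set (E × E)} (hQ : Q ⊆ normalBundle W)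
    (h : IsLocalDiffeo W Q) : IsLocalHomeomorph (proj hQ) := by
  classical
  refine IsLocalHomeomorph.mk _ fun z => ?_
  obtain ⟨O, V, f, hO, hzO, hV, hf, hQO⟩ := h z z.2
  have hmem : ∀ x ∈ W ∩ V, (x, f x) ∈ Q ∩ O := fun x hx => by
    rw [hQO]; exact mem_image_of_mem _ hx
  have hinv : ∀ y ∈ Q ∩ O, y.1 ∈ W ∩ V ∧ y.2 = f y.1 := fun y hy => by
    rw [hQO] at hy
    obtain ⟨x, hx, rfl⟩ := hy
    exact ⟨hx, rfl⟩
  have hc : Continuous (proj hQ) :=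
    Continuous.subtype_mk (continuous_fst.comp continuous_subtype_val) _
  let φ : OpenPartialHomeomorph Q W :=
    { toFun := proj hQ
      -- Off the target the value is arbitrary; `z` is just an available point of `Q`.
      invFun := fun x => if hx : (x : E) ∈ V then ⟨(x, f x), (hmem x ⟨x.2, hx⟩).1⟩ else z
      source := {y | (y : E × E) ∈ O}
      target := {x | (x : E) ∈ V}
      map_source' := fun y hy => (hinv y ⟨y.2, hy⟩).1.2
      map_target' := fun x hx => by
        have hx' : (x : E) ∈ V := hx
        simp only [dif_pos hx', mem_ofPred_eq]
        exact (hmem x ⟨x.2, hx⟩).2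
      left_inv' := fun y hy => by
        have h1 := hinv y ⟨y.2, hy⟩
        have h2 : ((proj hQ y : W) : E) ∈ V := h1.1.2
        rw [dif_pos h2]
        exact Subtype.ext (Prod.ext rfl h1.2.symm)
      right_inv' := fun x hx => by
        have hx' : (x : E) ∈ V := hx
        rw [dif_pos hx']
        rfl
      open_source := hO.preimage continuous_subtype_val
      open_target := hV.preimage continuous_subtype_val
      continuousOn_toFun := hc.continuousOn
      continuousOn_invFun := by
        rw [Topology.IsInducing.subtypeVal.continuousOn_iff]
        have h1 : ContinuousOn (fun x : W => ((x : E), f x)) {x : W | (x : E) ∈ V} :=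
          continuous_subtype_val.continuousOn.prodMk
            (hf.1.continuousOn.comp continuous_subtype_val.continuousOn fun x hx => ⟨x.2, hx⟩)
        refine h1.congr fun x hx => ?_
        have hx' : (x : E) ∈ V := hx
        simp only [Function.comp, dif_pos hx'] }
  exact ⟨φ, hzO, fun _ _ => rfl⟩

/-- If `Q` is bounded in the fibre direction and closed over `A`, then the image in `A` of a relatively
closed subset of `Q` is relatively closed. -/
theorem mem_image_fst_of_mem_closure {Q T : Set (E × E)} {A : Set E} {M : ℝ}
    (hM : ∀ z ∈ Q, ‖z.2‖ ≤ M) (hcl : ∀ z ∈ closure Q, z.1 ∈ A → z ∈ Q) (hT : T ⊆ Q)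
    (hTcl : ∀ z ∈ closure T, z ∈ Q → z ∈ T) {x : E} (hx : x ∈ A)
    (hxT : x ∈ closure (Prod.fst '' T)) : x ∈ Prod.fst '' T := by
  obtain ⟨u, hu, hux⟩ := mem_closure_iff_seq_limit.1 hxT
  choose z hzT hzu using hu
  obtain ⟨v, -, φ, hφ, hv⟩ := (isCompact_closedBall (0 : E) M).tendsto_subseq
    (x := fun n => (z n).2) fun n => mem_closedBall_zero_iff.2 (hM _ (hT (hzT n)))
  have hlim : Tendsto (fun n => z (φ n)) atTop (𝓝 (x, v)) := by
    refine Tendsto.prodMk_nhds ?_ hv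
    have : Tendsto (fun n => u (φ n)) atTop (𝓝 x) := hux.comp hφ.tendsto_atTop
    simpa [hzu] using this
  have h1 : (x, v) ∈ closure T := mem_closure_of_tendsto hlim (Eventually.of_forall fun n => hzT _)
  exact ⟨(x, v), hTcl _ h1 (hcl _ (closure_mono hT h1) hx), rfl⟩

/-- Boundedness of the fibre coordinate and closedness over `W ∩ Ω` act as properness: fibres are
compact and discrete, hence finite, and the projection to `W ∩ Ω` is closed. A closed local
homeomorphism with finite fibres is a covering; empty fibres are allowed here, and are discarded by
restricting to the range. -/
theorem IsLocalDiffeo.isCoveringMapOn {Q : Set (E × E)} (hQ : Q ⊆ normalBundle W)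
    (h : IsLocalDiffeo W Q) {Ω : Set E} (hΩ : IsOpen Ω) (hQΩ : ∀ z ∈ Q, z.1 ∈ Ω) {M : ℝ}
    (hM : ∀ z ∈ Q, ‖z.2‖ ≤ M) (hcl : ∀ z ∈ closure Q, z.1 ∈ W ∩ Ω → z ∈ Q) :
    IsCoveringMapOn (proj hQ) (range (proj hQ)) := by
  set s : Set W := {x | (x : E) ∈ Ω} with hs
  have hso : IsOpen s := hΩ.preimage continuous_subtype_val
  have hpre : proj hQ ⁻¹' s = univ := eq_univ_of_forall fun z => hQΩ z z.2
  refine IsCoveringMapOn.mono (t := range (proj hQ)) (s := s) ?_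
    (range_subset_iff.2 fun z => hQΩ z z.2)
  have hloc := h.isLocalHomeomorph hQ
  have hdisc : ∀ x : W, (proj hQ ⁻¹' {x}).Finite := by
    intro x
    have hd : IsDiscrete (proj hQ ⁻¹' {x}) := IsDiscrete.of_openPartialHomeomorph (proj hQ) subset_rfl
      fun e _ => by
        obtain ⟨φ, hφ, h2⟩ := hloc e
        exact ⟨φ, hφ, h2.symm⟩
    by_cases hx : (x : E) ∈ Ω
    swap
    · convert Set.finite_empty
      refine eq_empty_of_forall_notMem fun z hz => hx ?_
      have : proj hQ z = x := hz
      rw [← this]; exact hQΩ z z.2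
    have himg : IsCompact ((↑) '' (proj hQ ⁻¹' {x}) : Set (E × E)) := by
      have hcl' : IsClosed ((↑) '' (proj hQ ⁻¹' {x}) : Set (E × E)) := by
        refine isClosed_of_closure_subset fun z hz => ?_
        have h1 : z.1 = x := by
          have : z ∈ closure (Prod.fst ⁻¹' {(x : E)}) := closure_mono (by
            rintro _ ⟨y, hy, rfl⟩
            exact congrArg Subtype.val hy) hz
          rwa [(isClosed_singleton.preimage continuous_fst).closure_eq] at this
        have h2 : z ∈ Q := hcl z (closure_mono (by rintro _ ⟨y, hy, rfl⟩; exact y.2) hz)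
          (by rw [h1]; exact ⟨x.2, hx⟩)
        exact ⟨⟨z, h2⟩, Subtype.ext h1, rfl⟩
      refine ((isCompact_singleton (x := (x : E))).prod
        (isCompact_closedBall (0 : E) M)).of_isClosed_subset hcl' ?_
      rintro _ ⟨y, hy, rfl⟩
      exact ⟨congrArg Subtype.val hy, mem_closedBall_zero_iff.2 (hM y y.2)⟩
    exact (Topology.IsInducing.subtypeVal.isCompact_iff.2 himg).finite hd
  have hcm : IsClosedMap (s.restrictPreimage (proj hQ)) := by
    intro T hT
    obtain ⟨T', hT', rfl⟩ := isClosed_induced_iff.1 hT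
    obtain ⟨T'', hT'', rfl⟩ := isClosed_induced_iff.1 hT'
    refine isClosed_of_closure_subset fun x hx => ?_
    have h1 : ((x : W) : E) ∈ closure (Prod.fst '' (Q ∩ T'')) := by
      have hcont : Continuous (fun x : s => ((x : W) : E)) :=
        continuous_subtype_val.comp continuous_subtype_val
      have := image_closure_subset_closure_image hcont (mem_image_of_mem _ hx)
      refine closure_mono ?_ this
      rintro _ ⟨_, ⟨y, hy, rfl⟩, rfl⟩
      exact ⟨y.1.1, ⟨y.1.2, hy⟩, rfl⟩
    obtain ⟨z, hz, hzx⟩ := mem_image_fst_of_mem_closure (A := W ∩ Ω) hM hcl inter_subset_left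
      (fun z hz hzQ => ⟨hzQ, by
        have := closure_mono inter_subset_right hz
        rwa [hT''.closure_eq] at this⟩) ⟨x.1.2, x.2⟩ h1
    refine ⟨⟨⟨z, hz.1⟩, hQΩ z hz.1⟩, hz.2, ?_⟩
    exact Subtype.ext (Subtype.ext hzx)
  refine IsCoveringMapOn.of_isCoveringMap_restrictPreimage _ hso (by rw [hpre]; exact isOpen_univ) ?_
  have hloc' : IsLocalHomeomorph (s.restrictPreimage (proj hQ)) := by
    have hcomp : IsLocalHomeomorph (Subtype.val ∘ s.restrictPreimage (proj hQ)) := by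
      change IsLocalHomeomorph (proj hQ ∘ Subtype.val)
      exact hloc.comp (hso.preimage hloc.continuous).isOpenEmbedding_subtypeVal.isLocalHomeomorph
    exact hcomp.of_comp hso.isOpenEmbedding_subtypeVal.isLocalHomeomorph
      (hloc.continuous.restrictPreimage)
  rw [isCoveringMap_iff_isCoveringMapOn_univ]
  refine hcm.isCoveringMapOn_of_isLocalHomeomorphOn ?_ (hloc'.isLocalHomeomorphOn.mono (subset_univ _))
  intro x _
  refine Set.Finite.of_finite_image (f := Subtype.val) ((hdisc x).subset ?_)
    Subtype.val_injective.injOn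
  rintro _ ⟨y, hy, rfl⟩
  exact congrArg Subtype.val hy

end

section

variable {E : Type*} [NormedAddCommGroup E] [InnerProductSpace ℝ E] [FiniteDimensional ℝ E]
variable {d : ℕ} {U : TopologicalSpace.Opens E}

/-! ### The local sections topology refines the differential Fell topology -/

/-- The embedding of `U × Gr_d(E)` in the normed space `E × (E →L[ℝ] E)`. -/
noncomputable def toPointProj (z : U × Gr E d) : E × (E →L[ℝ] E) := (z.1, z.2.1.starProjection)

theorem isInducing_toPointProj : IsInducing (toPointProj : U × Gr E d → E × (E →L[ℝ] E)) := by
  have h : IsInducing (fun L : Gr E d => L.1.starProjection) := ⟨rfl⟩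
  exact IsInducing.prodMap (f := (Subtype.val : U → E)) Topology.IsInducing.subtypeVal h

/-- The point of the Gauss image of `W` over a point of `W`. -/
noncomputable def ProperSubmanifold.gaussPoint (W : ProperSubmanifold d U) {x : E}
    (hx : x ∈ W.carrier) : U × Gr E d :=
  (⟨x, W.subset hx⟩, ⟨tangentSpace W.carrier x, finrank_tangentSpace W.isSubmanifold hx⟩)

theorem ProperSubmanifold.gaussPoint_mem (W : ProperSubmanifold d U) {x : E}
    (hx : x ∈ W.carrier) : W.gaussPoint hx ∈ gaussImage W := ⟨hx, rfl⟩

theorem ProperSubmanifold.toPointProj_gaussPoint (W : ProperSubmanifold d U) {x : E}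
    (hx : x ∈ W.carrier) :
    toPointProj (W.gaussPoint hx) = (x, (tangentSpace W.carrier x).starProjection) := rfl

theorem ProperSubmanifold.eq_gaussPoint (W : ProperSubmanifold d U) {z : U × Gr E d}
    (hz : z ∈ gaussImage W) : z = W.gaussPoint hz.1 :=
  Prod.ext rfl (Subtype.ext hz.2)

theorem IsLocalDiffeo.norm_lt {W : Set E} {Q : Set (E × E)} (h : IsLocalDiffeo W Q) {ε : ℝ}
    (hsize : ∀ (V : Set E) (f : E → E), IsOpen V → IsSmoothSection W (W ∩ V) f →
      (∀ x ∈ W ∩ V, (x, f x) ∈ Q) → ∀ x ∈ W ∩ V, sectionSize W (W ∩ V) f x < ε)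
    {z : E × E} (hz : z ∈ Q) : ‖z.2‖ < ε := by
  obtain ⟨O, V, f, hO, hzO, hV, hf, hQO⟩ := h z hz
  have hz' : z ∈ Q ∩ O := ⟨hz, hzO⟩
  have hsub : ∀ x ∈ W ∩ V, (x, f x) ∈ Q ∩ O := fun x hx => by
    rw [hQO]; exact mem_image_of_mem _ hx
  rw [hQO] at hz'
  obtain ⟨x, hx, rfl⟩ := hz'
  exact (norm_le_sectionSize _ _ _).trans_lt
    (hsize V f hV hf (fun x hx => (hsub x hx).1) x hx)

/-- A sheet of a `C¹`-small multisection has tangent spaces close to those of `W`. -/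
theorem ProperSubmanifold.exists_tangent_close (W : ProperSubmanifold d U) {K : Set E}
    (hK : IsCompact K) (hKU : K ⊆ U) {η : ℝ} (hη : 0 < η) :
    ∃ ε > 0, ∀ (W' : ProperSubmanifold d U) (Q : Set (E × E)), IsLocalDiffeo W.carrier Q →
      normalExp '' Q ∩ K = W'.carrier ∩ K →
      (∀ (V : Set E) (f : E → E), IsOpen V → IsSmoothSection W.carrier (W.carrier ∩ V) f →
        (∀ x ∈ W.carrier ∩ V, (x, f x) ∈ Q) →
        ∀ x ∈ W.carrier ∩ V, sectionSize W.carrier (W.carrier ∩ V) f x < ε) →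
      ∀ z ∈ Q, z.1 ∈ K → z.1 + z.2 ∈ interior K →
        ‖(tangentSpace W'.carrier (z.1 + z.2)).starProjection -
          (tangentSpace W.carrier z.1).starProjection‖ < η := by
  obtain ⟨C, hC0, hC⟩ := W.isSubmanifold.exists_lipschitz_starProjection_compact
    (W.proper K hK hKU) inter_subset_left
  -- This makes `(C + 1) * ε` at most `1 / 2`, and the resulting bound `3 * ((C + 1) * ε)` at most
  -- `η / 2`.
  refine ⟨min (1 / 2) (η / 6) / (C + 1), by positivity, ?_⟩
  set ε := min (1 / 2) (η / 6) / (C + 1) with hε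
  have hCε : (C + 1) * ε = min (1 / 2) (η / 6) := by rw [hε]; field_simp
  intro W' Q hQ hexp hsize z hz hzK hzK'
  obtain ⟨O, V, f, hO, hzO, hV, hf, hQO⟩ := hQ z hz
  have hz' : z ∈ Q ∩ O := ⟨hz, hzO⟩
  have hsub : ∀ x ∈ W.carrier ∩ V, (x, f x) ∈ Q := fun x hx => by
    have : (x, f x) ∈ Q ∩ O := by rw [hQO]; exact mem_image_of_mem _ hx
    exact this.1
  have hmem : ∀ x ∈ W.carrier ∩ V, x + f x ∈ K → x + f x ∈ W'.carrier := fun x hx hxK =>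
    ((Set.ext_iff.1 hexp (x + f x)).1 ⟨⟨_, hsub x hx, rfl⟩, hxK⟩).1
  rw [hQO] at hz'
  obtain ⟨x, hx, rfl⟩ := hz'
  dsimp only at hzK hzK' ⊢
  -- The displaced sheet is known to lie in `W'` only inside `K`; that is why its point over `x` has
  -- to be interior to `K`.
  have hev : ∀ᶠ x' in 𝓝[W.carrier ∩ V] x, x' + f x' ∈ W'.carrier := by
    have hc : ContinuousWithinAt (fun x' => x' + f x') (W.carrier ∩ V) x :=
      continuousWithinAt_id.add (hf.1.continuousOn x hx)
    filter_upwards [self_mem_nhdsWithin, hc.eventually (isOpen_interior.mem_nhds hzK')]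
      with x' h1 h2 using hmem x' h1 (interior_subset h2)
  refine (W.isSubmanifold.norm_starProjection_sub_le_of_sectionSize W'.isSubmanifold hV hf hx hC0
    (hC x ⟨hx.1, hzK⟩) hev (hmem x hx (interior_subset hzK')) (hsize V f hV hf hsub x hx).le
    (by rw [hCε]; exact min_le_left _ _)).trans_lt ?_
  rw [hCε]
  have := min_le_right (1 / 2) (η / 6)
  linarith

/-- Take for `K` a ball about a point `x` of `W` whose Gauss point lies in `O`. As `Q` has a point
over `x`, displacing `x` by it gives a point of `W'` with nearby position and tangent plane. -/
theorem ProperSubmanifold.exists_lsNhd_subset_hit (W : ProperSubmanifold d U)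
    {O : Set (U × Gr E d)} (hO : IsOpen O) (hW : (gaussImage W ∩ O).Nonempty) :
    ∃ K : Set E, IsCompact K ∧ K ⊆ U ∧ ∃ ε : ℝ, 0 < ε ∧
      lsNhd W K ε ⊆ {W' | (gaussImage W' ∩ O).Nonempty} := by
  obtain ⟨z, hzW, hzO⟩ := hW
  obtain ⟨x, hx⟩ : ∃ x, x = (z.1 : E) := ⟨_, rfl⟩
  have hxW : x ∈ W.carrier := hx ▸ hzW.1
  have hz : z = W.gaussPoint hxW := by
    subst hx; exact W.eq_gaussPoint hzW
  rw [hz] at hzO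
  have hnh := hO.mem_nhds hzO
  rw [isInducing_toPointProj.nhds_eq_comap, W.toPointProj_gaussPoint] at hnh
  obtain ⟨S, hS, hSO⟩ := hnh
  obtain ⟨r, hr, hrS⟩ := Metric.mem_nhds_iff.1 hS
  obtain ⟨r', hr', hrU⟩ := Metric.nhds_basis_closedBall.mem_iff.1
    (U.isOpen.mem_nhds (W.subset hxW))
  have hK : IsCompact (Metric.closedBall x r') := isCompact_closedBall _ _
  obtain ⟨ε, hε, hclose⟩ := W.exists_tangent_close hK hrU hr
  refine ⟨_, hK, hrU, min ε (min r r'), by positivity, ?_⟩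
  rintro W' ⟨Q, hQN, hQdom, hhit, hloc, -, hexp, hsize⟩
  obtain ⟨v, hv⟩ := hhit x ⟨hxW, Metric.mem_closedBall_self hr'.le⟩
  have hvn := hloc.norm_lt hsize hv
  simp only [lt_min_iff] at hvn
  have hint : x + v ∈ interior (Metric.closedBall x r') :=
    Metric.ball_subset_interior_closedBall (by simpa [Metric.mem_ball, dist_eq_norm] using hvn.2.2)
  have hT := hclose W' Q hloc hexp (fun V f hV hf hfQ y hy =>
    (hsize V f hV hf hfQ y hy).trans_le (min_le_left _ _)) (x, v) hv
    (Metric.mem_closedBall_self hr'.le) hint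
  have hW' : x + v ∈ W'.carrier :=
    ((Set.ext_iff.1 hexp (x + v)).1 ⟨⟨_, hv, rfl⟩, interior_subset hint⟩).1
  refine ⟨W'.gaussPoint hW', W'.gaussPoint_mem hW', hSO (hrS ?_)⟩
  rw [W'.toPointProj_gaussPoint, Metric.mem_ball, Prod.dist_eq, max_lt_iff, dist_eq_norm,
    dist_eq_norm]
  exact ⟨by simpa using hvn.2.1, hT⟩

/-- Take for `K` a thickening of the projection of `C` to `U`, so that a short normal vector ending
on that projection also starts in `K`. Over `K` the Gauss image of `W` is compact, hence at positive
distance `ρ` from `C`, and the Gauss points of `W'` in question are within `ρ` of it. -/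
theorem ProperSubmanifold.exists_lsNhd_subset_miss (W : ProperSubmanifold d U)
    {C : Set (U × Gr E d)} (hC : IsCompact C) (hW : gaussImage W ⊆ Cᶜ) :
    ∃ K : Set E, IsCompact K ∧ K ⊆ U ∧ ∃ ε : ℝ, 0 < ε ∧
      lsNhd W K ε ⊆ {W' | gaussImage W' ⊆ Cᶜ} := by
  have hK₀ : IsCompact ((fun z : U × Gr E d => (z.1 : E)) '' C) :=
    hC.image (continuous_subtype_val.comp continuous_fst)
  obtain ⟨r, hr, hrU⟩ := hK₀.exists_cthickening_subset_open U.isOpen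
    (by rintro _ ⟨z, -, rfl⟩; exact z.1.2)
  set K := Metric.cthickening r ((fun z : U × Gr E d => (z.1 : E)) '' C) with hKdef
  have hK : IsCompact K := hK₀.cthickening
  have hG : IsCompact ((fun x => (x, (tangentSpace W.carrier x).starProjection)) ''
      (W.carrier ∩ K)) :=
    (W.proper K hK hrU).image_of_continuousOn (continuousOn_id.prodMk
      (W.isSubmanifold.continuousOn_starProjection.mono inter_subset_left))
  have hC' : IsCompact (toPointProj '' C) := hC.image isInducing_toPointProj.continuous
  have hdisj : Disjoint ((fun x => (x, (tangentSpace W.carrier x).starProjection)) ''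
      (W.carrier ∩ K)) (toPointProj '' C) := by
    rw [Set.disjoint_left]
    rintro _ ⟨x, ⟨hxW, hxK⟩, rfl⟩ ⟨z, hzC, hz⟩
    have h1 : (z.1 : E) = x := congrArg Prod.fst hz
    subst h1
    refine hW (a := z) ⟨hxW, ?_⟩ hzC
    exact Submodule.starProjection_inj.1 (congrArg Prod.snd hz)
  obtain ⟨ρ, hρ, hρd⟩ := hdisj.exists_thickenings hG hC'.isClosed
  obtain ⟨ε, hε, hclose⟩ := W.exists_tangent_close hK hrU hρ
  refine ⟨K, hK, hrU, min ε (min ρ r), by positivity, ?_⟩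
  rintro W' ⟨Q, hQN, hQdom, hhit, hloc, -, hexp, hsize⟩ z hzW' hzC
  have hzint : (z.1 : E) ∈ interior K := by
    have h1 : Metric.thickening r ((fun z : U × Gr E d => (z.1 : E)) '' C) ⊆ K :=
      Metric.thickening_subset_cthickening _ _
    exact interior_mono h1 (by
      rw [Metric.isOpen_thickening.interior_eq]
      exact Metric.self_subset_thickening hr _ (mem_image_of_mem _ hzC))
  obtain ⟨⟨⟨x, v⟩, hxv, hxz⟩, -⟩ := (Set.ext_iff.1 hexp (z.1 : E)).2
    ⟨hzW'.1, interior_subset hzint⟩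
  change x + v = (z.1 : E) at hxz
  have hvn := hloc.norm_lt hsize hxv
  simp only [lt_min_iff] at hvn
  have hxK : x ∈ K := by
    refine Metric.mem_cthickening_of_dist_le x (z.1 : E) r _ (mem_image_of_mem _ hzC) ?_
    rw [← hxz, dist_eq_norm]
    simpa using hvn.2.2.le
  have hT := hclose W' Q hloc hexp (fun V f hV hf hfQ y hy =>
    (hsize V f hV hf hfQ y hy).trans_le (min_le_left _ _)) (x, v) hxv hxK
    (by change x + v ∈ _; rwa [hxz])
  dsimp only at hT
  rw [hxz, ← hzW'.2] at hT
  refine Set.disjoint_left.1 hρd (?_ : toPointProj z ∈ _)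
    (Metric.self_subset_thickening hρ _ (mem_image_of_mem _ hzC))
  refine Metric.mem_thickening_iff.2 ⟨_, mem_image_of_mem _ ⟨(hQN hxv).1, hxK⟩, ?_⟩
  change dist ((z.1 : E), z.2.1.starProjection) _ < ρ
  rw [Prod.dist_eq, max_lt_iff, dist_eq_norm, dist_eq_norm]
  exact ⟨by rw [← hxz]; simpa using hvn.2.1, hT⟩

theorem lsTopology_le_differentialFellTopology :
    (lsTopology U : TopologicalSpace (ProperSubmanifold d U)) ≤ differentialFellTopology U := by
  rw [differentialFellTopology, fellTopology, induced_generateFrom_eq]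
  refine le_generateFrom ?_
  rintro _ ⟨S, ⟨O, hO, rfl⟩ | ⟨C, hC, rfl⟩, rfl⟩ W hW
  · exact W.exists_lsNhd_subset_hit hO hW
  · exact W.exists_lsNhd_subset_miss hC hW

/-! ### Compactness of the Grassmannian -/

/-- The trace of a projection is its rank, so fixing the dimension is a closed condition on
operators. -/
theorem range_starProjection_eq : range (fun L : Gr E d => L.1.starProjection) =
    {p : E →L[ℝ] E | p ∘L p = p ∧ (∀ x y, inner ℝ (p x) y = inner ℝ x (p y)) ∧
      LinearMap.trace ℝ E (p : E →ₗ[ℝ] E) = d} := by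
  have htr : ∀ S : Submodule ℝ E, LinearMap.trace ℝ E (S.starProjection : E →ₗ[ℝ] E) =
      Module.finrank ℝ S := fun S => by
    refine LinearMap.IsProj.trace (p := S) ⟨fun x => ?_, fun x hx => ?_⟩
    · exact Submodule.starProjection_apply_mem _ _
    · exact Submodule.starProjection_eq_self_iff.2 hx
  ext p
  constructor
  · rintro ⟨⟨S, hS⟩, rfl⟩
    refine ⟨S.isIdempotentElem_starProjection, S.starProjection_isSymmetric, ?_⟩
    rw [htr, hS]
  · rintro ⟨h1, h2, h3⟩
    have h4 : LinearMap.IsSymmetricProjection (p : E →ₗ[ℝ] E) :=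
      ⟨LinearMap.ext fun x => DFunLike.congr_fun h1 x, h2⟩
    obtain ⟨S, hSo, hS⟩ := LinearMap.isSymmetricProjection_iff_eq_coe_starProjection.1 h4
    have hpS : S.starProjection = p := ContinuousLinearMap.coe_injective hS.symm
    refine ⟨⟨S, ?_⟩, hpS⟩
    have := htr S
    rw [hpS, h3] at this
    exact_mod_cast this.symm

/-- Compactness of the fibres of `U × Gr E d → U` lets a Fell miss-condition constrain the position
of `W'` irrespective of its tangent planes. -/
instance : CompactSpace (Gr E d) := by
  have hind : IsInducing (fun L : Gr E d => L.1.starProjection) := ⟨rfl⟩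
  refine ⟨hind.isCompact_iff.2 ?_⟩
  rw [image_univ]
  have hcl : IsClosed (range (fun L : Gr E d => L.1.starProjection)) := by
    rw [range_starProjection_eq]
    refine IsClosed.inter ?_ (IsClosed.inter ?_ ?_)
    · exact isClosed_eq (f := fun p : E →L[ℝ] E => p ∘L p) (by fun_prop) continuous_id
    · have h : IsClosed (⋂ (x : E) (y : E), {p : E →L[ℝ] E | inner ℝ (p x) y = inner ℝ x (p y)}) :=
        isClosed_iInter fun x => isClosed_iInter fun y => isClosed_eq (by fun_prop) (by fun_prop)
      have e : {p : E →L[ℝ] E | ∀ x y : E, inner ℝ (p x) y = inner ℝ x (p y)} =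
          ⋂ (x : E) (y : E), {p : E →L[ℝ] E | inner ℝ (p x) y = inner ℝ x (p y)} := by
        ext p
        simp only [mem_iInter]
        rfl
      rw [← e] at h
      exact h
    · refine isClosed_eq ?_ continuous_const
      exact (LinearMap.trace ℝ E ∘ₗ ContinuousLinearMap.coeLM ℝ).continuous_of_finiteDimensional
  have : ProperSpace (E →L[ℝ] E) := FiniteDimensional.proper ℝ _
  refine (isCompact_closedBall (0 : E →L[ℝ] E) 1).of_isClosed_subset hcl ?_
  rintro _ ⟨L, rfl⟩
  simpa using L.1.starProjection_norm_le

/-! ### Neighbourhoods in the differential Fell topology -/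

theorem ProperSubmanifold.eventually_hit (W : ProperSubmanifold d U) {O : Set (U × Gr E d)}
    (hO : IsOpen O) (hW : (gaussImage W ∩ O).Nonempty) :
    ∀ᶠ W' in @nhds _ (differentialFellTopology U) W, (gaussImage W' ∩ O).Nonempty := by
  let _ := differentialFellTopology (d := d) U
  refine IsOpen.mem_nhds (s := {W' | (gaussImage W' ∩ O).Nonempty}) ?_ hW
  exact ⟨{A : TopologicalSpace.Closeds (U × Gr E d) | ((A : Set (U × Gr E d)) ∩ O).Nonempty},
    TopologicalSpace.isOpen_generateFrom_of_mem (Or.inl ⟨O, hO, rfl⟩), rfl⟩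

theorem ProperSubmanifold.eventually_miss (W : ProperSubmanifold d U) {C : Set (U × Gr E d)}
    (hC : IsCompact C) (hW : gaussImage W ⊆ Cᶜ) :
    ∀ᶠ W' in @nhds _ (differentialFellTopology U) W, gaussImage W' ⊆ Cᶜ := by
  let _ := differentialFellTopology (d := d) U
  refine IsOpen.mem_nhds (s := {W' | gaussImage W' ⊆ Cᶜ}) ?_ hW
  exact ⟨{A : TopologicalSpace.Closeds (U × Gr E d) | (A : Set (U × Gr E d)) ⊆ Cᶜ},
    TopologicalSpace.isOpen_generateFrom_of_mem (Or.inr ⟨C, hC, rfl⟩), rfl⟩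

theorem isCompact_preimage_fst {K : Set E} (hK : IsCompact K) (hKU : K ⊆ U) :
    IsCompact {z : U × Gr E d | (z.1 : E) ∈ K} := by
  have h1 : IsCompact ((Subtype.val : U → E) ⁻¹' K) := by
    rw [Topology.IsInducing.subtypeVal.isCompact_preimage_iff]
    · exact hK
    · rw [Subtype.range_coe]; exact hKU
  have h2 : {z : U × Gr E d | (z.1 : E) ∈ K} = ((Subtype.val : U → E) ⁻¹' K) ×ˢ univ := by
    ext z; simp
  rw [h2]
  exact h1.prod isCompact_univ

theorem ProperSubmanifold.eventually_exists_dist_lt (W : ProperSubmanifold d U) {x : E}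
    (hx : x ∈ W.carrier) {r : ℝ} (hr : 0 < r) :
    ∀ᶠ W' in @nhds _ (differentialFellTopology U) W, ∃ y ∈ W'.carrier, dist y x < r := by
  have hO : IsOpen {z : U × Gr E d | dist (z.1 : E) x < r} :=
    isOpen_lt (by fun_prop) continuous_const
  refine (W.eventually_hit hO ⟨W.gaussPoint hx, W.gaussPoint_mem hx, ?_⟩).mono ?_
  · change dist x x < r
    simpa using hr
  · rintro W' ⟨z, hz, hz'⟩
    exact ⟨z.1, hz.1, hz'⟩

/-- The compact set to be missed consists of all planes at points of `K` whose distance to every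
point of `W` is at least `r`. -/
theorem ProperSubmanifold.eventually_near (W : ProperSubmanifold d U) {K : Set E}
    (hK : IsCompact K) (hKU : K ⊆ U) {r : ℝ} (hr : 0 < r) :
    ∀ᶠ W' in @nhds _ (differentialFellTopology U) W, ∀ y ∈ W'.carrier, y ∈ K →
      ∃ x ∈ W.carrier, dist y x < r := by
  have hC : IsCompact ({z : U × Gr E d | (z.1 : E) ∈ K} ∩
      ⋂ x ∈ W.carrier, {z : U × Gr E d | r ≤ dist (z.1 : E) x}) :=
    (isCompact_preimage_fst hK hKU).inter_right
      (isClosed_biInter fun x _ => isClosed_le continuous_const (by fun_prop))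
  refine (W.eventually_miss hC ?_).mono ?_
  · rintro z hz ⟨-, hz'⟩
    have : r ≤ dist (z.1 : E) z.1 := mem_iInter₂.1 hz' z.1 hz.1
    rw [dist_self] at this
    exact hr.not_ge this
  · intro W' hW' y hy hyK
    by_contra! hcon
    exact hW' (W'.gaussPoint_mem hy) ⟨hyK, mem_iInter₂.2 hcon⟩

/-- The set to be missed consists of the planes over `K` that are `η`-far from `T_x W` for some `x ∈
W ∩ K` within `δ`. It is compact as the projection of a compact set of pairs, and `W` misses it by
uniform continuity of its tangent planes over `K`. -/
theorem ProperSubmanifold.exists_eventually_tangent_close (W : ProperSubmanifold d U) {K : Set E}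
    (hK : IsCompact K) (hKU : K ⊆ U) {η : ℝ} (hη : 0 < η) :
    ∃ δ > 0, ∀ᶠ W' in @nhds _ (differentialFellTopology U) W,
      ∀ y ∈ W'.carrier, y ∈ K → ∀ x ∈ W.carrier, x ∈ K → dist y x ≤ δ →
        ‖(tangentSpace W'.carrier y).starProjection -
          (tangentSpace W.carrier x).starProjection‖ < η := by
  have hWK := W.proper K hK hKU
  have hcont : ContinuousOn (fun x => (tangentSpace W.carrier x).starProjection)
      (W.carrier ∩ K) := W.isSubmanifold.continuousOn_starProjection.mono inter_subset_left
  obtain ⟨δ, hδ, hunif⟩ := Metric.uniformContinuousOn_iff.1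
    (hWK.uniformContinuousOn_of_continuous hcont) η hη
  refine ⟨δ / 2, by positivity, ?_⟩
  set A : Set (E × (U × Gr E d)) := (W.carrier ∩ K) ×ˢ {z | (z.1 : E) ∈ K} with hA
  have hAc : IsCompact A := hWK.prod (isCompact_preimage_fst hK hKU)
  have hcontA : ContinuousOn (fun p : E × (U × Gr E d) =>
      ‖p.2.2.1.starProjection - (tangentSpace W.carrier p.1).starProjection‖) A := by
    have h1 : Continuous (fun L : Gr E d => L.1.starProjection) := continuous_induced_dom
    refine ContinuousOn.norm (ContinuousOn.sub ?_ ?_)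
    · exact (h1.comp (continuous_snd.comp continuous_snd)).continuousOn
    · exact hcont.comp continuous_fst.continuousOn fun p hp => hp.1
  have hB : IsCompact (A ∩ {p | dist (p.2.1 : E) p.1 ≤ δ / 2} ∩
      (fun p : E × (U × Gr E d) =>
        ‖p.2.2.1.starProjection - (tangentSpace W.carrier p.1).starProjection‖) ⁻¹' Ici η) := by
    have hcl : IsClosed {p : E × (U × Gr E d) | dist (p.2.1 : E) p.1 ≤ δ / 2} :=
      isClosed_le (by fun_prop) continuous_const
    have h2 := hAc.inter_right hcl
    obtain ⟨T, hT, hTA⟩ := continuousOn_iff_isClosed.1 hcontA (Ici η) isClosed_Ici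
    have h3 : A ∩ {p | dist (p.2.1 : E) p.1 ≤ δ / 2} ∩ (fun p : E × (U × Gr E d) =>
        ‖p.2.2.1.starProjection - (tangentSpace W.carrier p.1).starProjection‖) ⁻¹' Ici η =
        (A ∩ {p | dist (p.2.1 : E) p.1 ≤ δ / 2}) ∩ T := by
      ext p
      have := Set.ext_iff.1 hTA p
      simp only [mem_inter_iff] at this ⊢
      tauto
    rw [h3]
    exact h2.inter_right hT
  refine (W.eventually_miss (hB.image continuous_snd) ?_).mono ?_
  · rintro z hz ⟨⟨x, z'⟩, ⟨⟨⟨⟨hxW, hxK⟩, hzK⟩, hd⟩, hη'⟩, rfl⟩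
    have h1 := hunif z'.1 ⟨hz.1, hzK⟩ x ⟨hxW, hxK⟩ (lt_of_le_of_lt hd (by linarith))
    rw [dist_eq_norm, ← hz.2] at h1
    exact h1.not_ge hη'
  · intro W' hW' y hy hyK x hx hxK hd
    by_contra! hcon
    exact hW' (W'.gaussPoint_mem hy) ⟨(x, W'.gaussPoint hy), ⟨⟨⟨⟨hx, hxK⟩, hyK⟩, hd⟩, hcon⟩, rfl⟩

/-! ### Nearest points and the multisection of a nearby submanifold -/

/-- A point of `W` nearest to `y` exists by properness in `U`, and the first variation of the
squared distance makes `y - x` normal there. -/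
theorem ProperSubmanifold.exists_nearest (W : ProperSubmanifold d U) {y x₀ : E}
    (hx₀ : x₀ ∈ W.carrier) (hU : Metric.closedBall y (dist y x₀) ⊆ U) :
    ∃ x, (x, y - x) ∈ normalBundle W.carrier ∧ dist y x ≤ dist y x₀ := by
  have hc := W.proper _ (isCompact_closedBall y (dist y x₀)) hU
  obtain ⟨x, ⟨hxW, hxb⟩, hmin⟩ := hc.exists_isMinOn
    ⟨x₀, hx₀, by rw [Metric.mem_closedBall, dist_comm]⟩
    (continuous_const.dist continuous_id : Continuous fun x => dist y x).continuousOn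
  have hxle : dist y x ≤ dist y x₀ := by rwa [Metric.mem_closedBall, dist_comm] at hxb
  have hmin' : ∀ p ∈ W.carrier, dist y x ≤ dist y p := by
    intro p hp
    by_cases h : dist y p ≤ dist y x₀
    · exact hmin ⟨hp, by rwa [Metric.mem_closedBall, dist_comm]⟩
    · exact hxle.trans (not_le.1 h).le
  refine ⟨x, ⟨hxW, fun u hu => ?_⟩, hxle⟩
  obtain ⟨γ, h0, hγ, hd⟩ := W.isSubmanifold.exists_curve hxW hu
  have hd' : HasDerivAt (fun t => ‖y - γ t‖ ^ 2) (2 * inner ℝ (y - γ 0) (-u)) 0 :=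
    (hd.const_sub y).norm_sq
  have hloc : IsLocalMin (fun t => ‖y - γ t‖ ^ 2) 0 := by
    filter_upwards [hγ] with t ht
    have := hmin' _ ht
    rw [dist_eq_norm, dist_eq_norm] at this
    simp only [h0]
    gcongr
  have h1 := hloc.hasDerivAt_eq_zero hd'
  rw [h0, inner_neg_right] at h1
  rw [real_inner_comm]
  linarith

/-- The set is the image, under the inverse of a slice chart, of the convex intersection of `L` with
a small ball. -/
theorem IsSubmanifold.exists_preconnected_nhds {W : Set E} (hW : IsSubmanifold d W) {x : E}
    (hx : x ∈ W) {Ω : Set E} (hΩ : Ω ∈ 𝓝 x) :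
    ∃ D ⊆ W ∩ Ω, IsPreconnected D ∧ D ∈ 𝓝[W] x := by
  obtain ⟨Φ, L, hxs, h⟩ := hW x hx
  have hpre : Φ.target ∩ Φ.symm ⁻¹' Ω ∈ 𝓝 (Φ x) := by
    refine inter_mem (Φ.open_target.mem_nhds (Φ.map_source hxs)) ?_
    refine (Φ.symm.continuousAt (Φ.map_source hxs)).preimage_mem_nhds ?_
    rwa [Φ.left_inv hxs]
  obtain ⟨r, hr, hrs⟩ := Metric.mem_nhds_iff.1 hpre
  refine ⟨Φ.symm '' (L ∩ Metric.ball (Φ x) r), ?_, ?_, ?_⟩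
  · rintro _ ⟨l, ⟨hlL, hlb⟩, rfl⟩
    have hl := hrs hlb
    refine ⟨?_, hl.2⟩
    rw [h.mem_iff _ (Φ.map_target hl.1), Φ.right_inv hl.1]
    exact hlL
  · refine IsPreconnected.image (L.convex.inter (convex_ball _ _)).isPreconnected _ ?_
    exact Φ.symm.continuousOn.mono fun l hl => (hrs hl.2).1
  · filter_upwards [self_mem_nhdsWithin, mem_nhdsWithin_of_mem_nhds
      ((Φ.continuousAt hxs).preimage_mem_nhds (Metric.ball_mem_nhds _ hr)),
      mem_nhdsWithin_of_mem_nhds (Φ.open_source.mem_nhds hxs)] with y hyW hyb hys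
    exact ⟨Φ y, ⟨(h.mem_iff y hys).1 hyW, hyb⟩, Φ.left_inv hys⟩

theorem IsSubmanifold.mem_normalBundle_of_mem_closure {W : Set E} (hW : IsSubmanifold d W)
    {z : E × E} (hz : z ∈ closure (normalBundle W)) (hzW : z.1 ∈ W) : z ∈ normalBundle W := by
  obtain ⟨u, hu, hlim⟩ := mem_closure_iff_seq_limit.1 hz
  refine ⟨hzW, (Submodule.starProjection_apply_eq_zero_iff _).1 ?_⟩
  have h1 : Tendsto (fun n => (u n).1) atTop (𝓝[W] z.1) :=
    tendsto_nhdsWithin_iff.2 ⟨hlim.fst_nhds, Eventually.of_forall fun n => (hu n).1⟩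
  have h3 : Tendsto (fun n => (tangentSpace W (u n).1).starProjection) atTop
      (𝓝 (tangentSpace W z.1).starProjection) :=
    (hW.continuousOn_starProjection z.1 hzW).tendsto.comp h1
  have h2 := (isBoundedBilinearMap_apply (𝕜 := ℝ) (E := E) (F := E)).continuous.tendsto
    ((tangentSpace W z.1).starProjection, z.2) |>.comp (h3.prodMk_nhds hlim.snd_nhds)
  refine tendsto_nhds_unique h2 ?_
  refine tendsto_const_nhds.congr fun n => ?_
  exact ((Submodule.starProjection_apply_eq_zero_iff _).2 (hu n).2).symm

/-- A normal vector of `W` ending near `W` is short, as long as it stays in the range where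
secants of `W` are nearly tangent. -/
theorem norm_le_of_secant {W : Set E} {x v x' : E} {δ : ℝ}
    (hv : v ∈ (tangentSpace W x)ᗮ) (hx' : ‖x + v - x'‖ < δ / 8)
    (hsec : ‖(x' - x) - (tangentSpace W x).starProjection (x' - x)‖ ≤ 1 / 2 * ‖x' - x‖) :
    ‖v‖ < δ / 2 := by
  set P := (tangentSpace W x).starProjection
  have hPv : P v = 0 := (Submodule.starProjection_apply_eq_zero_iff _).2 hv
  set w := x' - x with hw
  have h1 : x + v - x' = v - w := by rw [hw]; abel
  rw [h1] at hx'
  have h2 : ‖P w‖ ≤ ‖v - w‖ := by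
    have := Submodule.norm_starProjection_apply_le (tangentSpace W x) (v - w)
    change ‖P (v - w)‖ ≤ _ at this
    rwa [map_sub, hPv, zero_sub, norm_neg] at this
  have h3 : ‖w‖ ≤ ‖P w‖ + ‖w - P w‖ := by
    simpa using norm_add_le (P w) (w - P w)
  have h4 : ‖v‖ ≤ ‖v - w‖ + ‖w‖ := by simpa using norm_add_le (v - w) w
  -- The secant bound gives `‖w‖ ≤ 2 * ‖P w‖ ≤ 2 * ‖v - w‖`, hence `‖v‖ ≤ 3 * ‖v - w‖ < 3 * δ / 8`.
  linarith [norm_nonneg (v - w)]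

/-- The part over `Ω` of the multisection of the normal bundle of `W`, with values of norm less
than `δ`, whose displaced graph is `W'`. -/
def multisection (W W' Ω : Set E) (δ : ℝ) : Set (E × E) :=
  {z | z ∈ normalBundle W ∧ z.1 ∈ Ω ∧ ‖z.2‖ < δ ∧ z.1 + z.2 ∈ W'}

/-- Projections at distance less than `1` leave no nonzero tangent vector of `W'` orthogonal to `T
W`. This is the transversality that `exists_section` needs. -/
theorem isLocalDiffeo_multisection {W W' Ω : Set E} (hW : IsSubmanifold d W)
    (hW' : IsSubmanifold d W') (hΩ : IsOpen Ω) {δ : ℝ}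
    (hT : ∀ z ∈ multisection W W' Ω δ, ‖(tangentSpace W' (z.1 + z.2)).starProjection -
      (tangentSpace W z.1).starProjection‖ < 1) :
    IsLocalDiffeo W (multisection W W' Ω δ) := by
  intro z hz
  have htrans : ∀ w ∈ tangentSpace W' (z.1 + z.2), w ∈ (tangentSpace W z.1)ᗮ → w = 0 := by
    intro w hw hw'
    by_contra h0
    have hpos : 0 < ‖w‖ := norm_pos_iff.2 h0
    have h1 : ((tangentSpace W' (z.1 + z.2)).starProjection -
        (tangentSpace W z.1).starProjection) w = w := by
      rw [sub_apply, Submodule.starProjection_eq_self_iff.2 hw,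
        (Submodule.starProjection_apply_eq_zero_iff _).2 hw', sub_zero]
    have h2 := ContinuousLinearMap.le_opNorm ((tangentSpace W' (z.1 + z.2)).starProjection -
        (tangentSpace W z.1).starProjection) w
    rw [h1] at h2
    nlinarith [hT z hz]
  obtain ⟨O, V, f, hO, hzO, hV, hf, hVO, hfW, hOV⟩ := hW.exists_section hW' hz.1 hz.2.2.2 htrans
  have hVo : IsOpen (V ∩ (fun x => (x, f x)) ⁻¹' (Ω ×ˢ Metric.ball 0 δ)) :=
    (continuousOn_id.prodMk hf.continuousOn).isOpen_inter_preimage hV (hΩ.prod Metric.isOpen_ball)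
  refine ⟨O ∩ Ω ×ˢ Metric.ball 0 δ, _, f, hO.inter (hΩ.prod Metric.isOpen_ball),
    ⟨hzO, hz.2.1, mem_ball_zero_iff.2 hz.2.2.1⟩, hVo,
    ⟨hf.mono fun x hx => hx.2.1, fun x hx => (hfW x ⟨hx.1, hx.2.1⟩).1⟩, ?_⟩
  ext y
  constructor
  · rintro ⟨⟨h1, h2, h3, h4⟩, h5, h6⟩
    obtain ⟨h7, h8⟩ := hOV y h5 h1 h4
    refine ⟨y.1, ⟨h1.1, h7, h2, ?_⟩, Prod.ext rfl h8⟩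
    change f y.1 ∈ _
    rw [h8]; exact h6.2
  · rintro ⟨x, ⟨hxW, hxV, hxb⟩, rfl⟩
    exact ⟨⟨(hfW x ⟨hxW, hxV⟩).1, hxb.1, mem_ball_zero_iff.1 hxb.2, (hfW x ⟨hxW, hxV⟩).2⟩,
      hVO x hxV, hxb⟩

/-- If the set of base points of a local diffeomorphism `Q → W` is relatively closed in `A`, and
meets a connected subset of `A`, then it contains that subset. -/
theorem IsLocalDiffeo.subset_image_fst {W A D : Set E} {Q : Set (E × E)} (h : IsLocalDiffeo W Q)
    (hA : A ⊆ W) (hcl : ∀ x ∈ A, x ∈ closure (Prod.fst '' Q) → x ∈ Prod.fst '' Q) (hDA : D ⊆ A)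
    (hD : IsPreconnected D) (hne : (D ∩ Prod.fst '' Q).Nonempty) : D ⊆ Prod.fst '' Q := by
  set R := Prod.fst '' Q
  -- The set `R` is open in `W`, and `u` is an open set of the ambient space with `W ∩ u = R`, as
  -- the definition of preconnectedness requires.
  set u : Set E := ⋃₀ {V | IsOpen V ∧ W ∩ V ⊆ R} with hu
  have huo : IsOpen u := isOpen_sUnion fun V hV => hV.1
  have hRu : R ⊆ u := by
    rintro _ ⟨z, hz, rfl⟩
    obtain ⟨O, V, f, hO, hzO, hV, hf, hQO⟩ := h z hz
    refine ⟨V, ⟨hV, fun x hx => ?_⟩, ?_⟩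
    · have : (x, f x) ∈ Q ∩ O := by rw [hQO]; exact mem_image_of_mem _ hx
      exact ⟨_, this.1, rfl⟩
    · have hz' : z ∈ Q ∩ O := ⟨hz, hzO⟩
      rw [hQO] at hz'
      obtain ⟨x, hx, rfl⟩ := hz'
      exact hx.2
  have huR : ∀ x ∈ W, x ∈ u → x ∈ R := by
    rintro x hxW ⟨V, hV, hxV⟩
    exact hV.2 ⟨hxW, hxV⟩
  intro x hx
  by_contra hxR
  obtain ⟨p, hpD, hpu, hpv⟩ := hD u (closure R)ᶜ huo isClosed_closure.isOpen_compl
    (fun y hy => by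
      by_cases hyR : y ∈ closure R
      · exact Or.inl (hRu (hcl y (hDA hy) hyR))
      · exact Or.inr hyR)
    (hne.mono (inter_subset_inter_right D hRu)) ⟨x, hx, fun hx' => hxR (hcl x (hDA hx) hx')⟩
  exact hpv (subset_closure (huR p (hA (hDA hpD)) hpu))

/-- Three Fell conditions on `W'` suffice: its tangent planes are close to those of `W`, its points
over a larger compact set are near `W`, and it comes near finitely many chosen points of `W ∩ K`.
The multisection `Q` is taken over a neighbourhood `Ω` of `K`, since points of `W' ∩ K` may be
displaced from points outside `K`. -/
theorem ProperSubmanifold.lsNhd_mem_nhds (W : ProperSubmanifold d U) {K : Set E}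
    (hK : IsCompact K) (hKU : K ⊆ U) {ε : ℝ} (hε : 0 < ε) :
    lsNhd W K ε ∈ @nhds _ (differentialFellTopology U) W := by
  obtain ⟨r₂, hr₂, hr₂U⟩ := hK.exists_cthickening_subset_open U.isOpen hKU
  -- Half of the room is for the base points in `Ω`, the other half for their displacements, so
  -- everything stays in `K₂ ⊆ U`.
  set r := r₂ / 2 with hr
  have hr0 : 0 < r := by positivity
  set K₂ := Metric.cthickening r₂ K with hK₂
  have hK₂c : IsCompact K₂ := hK.cthickening
  set Ω := Metric.thickening r K with hΩ
  have hΩo : IsOpen Ω := Metric.isOpen_thickening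
  have hnear : ∀ x ∈ Ω, ∀ y, dist y x ≤ r → y ∈ K₂ := by
    intro x hx y hy
    obtain ⟨k, hk, hxk⟩ := Metric.mem_thickening_iff.1 hx
    refine Metric.mem_cthickening_of_dist_le y k _ _ hk ((dist_triangle y x k).trans ?_)
    linarith
  have hKΩ : K ⊆ Ω := Metric.self_subset_thickening hr0 K
  have hΩK₂ : Ω ⊆ K₂ := fun x hx => hnear x hx x (by simpa using hr0.le)
  have hWK₂ : IsCompact (W.carrier ∩ K₂) := W.proper K₂ hK₂c hr₂U
  obtain ⟨C, hC0, hC⟩ := W.isSubmanifold.exists_lipschitz_starProjection_compact hWK₂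
    inter_subset_left
  obtain ⟨δs, hδs, hsec⟩ := W.isSubmanifold.exists_secant_compact hWK₂ inter_subset_left
    (c := 1 / 2) (by norm_num)
  -- The section size will be at most `‖f x‖ + 4 * η`, where `‖f x‖ < ε / 2` and `4 * η ≤ ε / 4`.
  set η := min (1 / 2) (ε / 16) with hη
  have hη0 : 0 < η := by positivity
  have hη1 : η ≤ 1 / 2 := min_le_left _ _
  have hη2 : η ≤ ε / 16 := min_le_right _ _
  obtain ⟨δT, hδT, hFT⟩ := W.exists_eventually_tangent_close hK₂c hr₂U hη0
  -- In order: the secant estimate applies to points up to `δ + δ / 8` apart; tangent planes are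
  -- compared; displacements stay in `K₂`; the section is short; and `sectionSize_le` applies.
  obtain ⟨δ, hδ0, hδs', hδT', hδr, hδε, hδC⟩ : ∃ δ > 0, 2 * δ ≤ δs ∧ δ ≤ δT ∧ δ ≤ r ∧
      δ ≤ ε / 2 ∧ C * δ ≤ 1 := by
    refine ⟨min (δs / 2) (min δT (min r (min (ε / 2) (1 / (C + 1))))), by positivity, ?_, ?_, ?_,
      ?_, ?_⟩
    · have := min_le_left (δs / 2) (min δT (min r (min (ε / 2) (1 / (C + 1)))))
      linarith
    · exact (min_le_right _ _).trans (min_le_left _ _)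
    · exact (min_le_right _ _).trans ((min_le_right _ _).trans (min_le_left _ _))
    · exact (min_le_right _ _).trans ((min_le_right _ _).trans ((min_le_right _ _).trans
        (min_le_left _ _)))
    · have h1 : min (δs / 2) (min δT (min r (min (ε / 2) (1 / (C + 1))))) ≤ 1 / (C + 1) :=
        (min_le_right _ _).trans ((min_le_right _ _).trans ((min_le_right _ _).trans
          (min_le_right _ _)))
      calc C * _ ≤ (C + 1) * (1 / (C + 1)) :=
            mul_le_mul (by linarith) h1 (by positivity) (by positivity)
        _ = 1 := by field_simp
  have hFN := W.eventually_near hK₂c hr₂U (r := δ / 8) (by positivity)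
  -- connected neighbourhoods in `W` of finitely many points, covering `W ∩ K`
  have hD : ∀ x ∈ W.carrier ∩ K, ∃ D ⊆ W.carrier ∩ Ω, IsPreconnected D ∧ ∃ s > 0, s ≤ δ ∧
      W.carrier ∩ Metric.ball x (2 * s) ⊆ D := by
    intro x hx
    obtain ⟨D, hDs, hDc, hDn⟩ := W.isSubmanifold.exists_preconnected_nhds hx.1
      (hΩo.mem_nhds (hKΩ hx.2))
    obtain ⟨s, hs, hsD⟩ := Metric.mem_nhdsWithin_iff.1 hDn
    refine ⟨D, hDs, hDc, min δ (s / 2), by positivity, min_le_left _ _, fun y hy => hsD ⟨?_, hy.1⟩⟩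
    have := min_le_right δ (s / 2)
    exact Metric.ball_subset_ball (by linarith) hy.2
  choose! D hDΩ hDc s hs0 hsδ hsD using hD
  obtain ⟨t, htK, htcov⟩ := (W.proper K hK hKU).elim_nhds_subcover (fun x => Metric.ball x (s x))
    (fun x hx => Metric.ball_mem_nhds _ (hs0 x hx))
  have hFH : ∀ᶠ W' in @nhds _ (differentialFellTopology U) W, ∀ x ∈ t,
      ∃ y ∈ W'.carrier, dist y x < s x :=
    (Filter.eventually_all_finset t).2 fun x hx =>
      W.eventually_exists_dist_lt (htK x hx).1 (hs0 x (htK x hx))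
  filter_upwards [hFT, hFN, hFH] with W' hT hN hH
  set Q := multisection W.carrier W'.carrier Ω δ with hQ
  have hQsum : ∀ z : E × E, z.1 ∈ Ω → ‖z.2‖ ≤ δ → z.1 + z.2 ∈ K₂ := fun z hz hz' =>
    hnear _ hz _ (by rw [dist_eq_norm]; simpa using hz'.trans hδr)
  have hQT : ∀ z ∈ Q, ‖(tangentSpace W'.carrier (z.1 + z.2)).starProjection -
      (tangentSpace W.carrier z.1).starProjection‖ < η := fun z hz =>
    hT _ hz.2.2.2 (hQsum z hz.2.1 hz.2.2.1.le) _ hz.1.1 (hΩK₂ hz.2.1)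
      (by rw [dist_eq_norm]; simpa using hz.2.2.1.le.trans hδT')
  -- No such vector has length between `δ / 2` and `δ`. Hence the strict bound in the definition of
  -- `Q` survives limits, and `Q` is closed over `W ∩ Ω`.
  have hshort : ∀ z ∈ normalBundle W.carrier, z.1 ∈ Ω → ‖z.2‖ ≤ δ → z.1 + z.2 ∈ W'.carrier →
      ‖z.2‖ < δ / 2 := by
    intro z hz hzΩ hzδ hzW'
    obtain ⟨x', hx'W, hx'⟩ := hN _ hzW' (hQsum z hzΩ hzδ)
    rw [dist_eq_norm] at hx'
    refine norm_le_of_secant hz.2 hx' (hsec z.1 ⟨hz.1, hΩK₂ hzΩ⟩ x' hx'W ?_)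
    have : ‖x' - z.1‖ ≤ ‖z.2‖ + ‖z.1 + z.2 - x'‖ := by
      have e : x' - z.1 = z.2 - (z.1 + z.2 - x') := by abel
      rw [e]; exact norm_sub_le _ _
    linarith
  have hQcl : ∀ z ∈ closure Q, z.1 ∈ W.carrier ∩ Ω → z ∈ Q := by
    rintro z hz ⟨hzW, hzΩ⟩
    have h1 : z ∈ normalBundle W.carrier :=
      W.isSubmanifold.mem_normalBundle_of_mem_closure (closure_mono (fun y hy => hy.1) hz) hzW
    have h2 : ‖z.2‖ ≤ δ := by
      have hc : IsClosed {z : E × E | ‖z.2‖ ≤ δ} := isClosed_le (by fun_prop) continuous_const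
      exact closure_minimal (fun y (hy : y ∈ Q) => hy.2.2.1.le) hc hz
    have h3 : z.1 + z.2 ∈ W'.carrier := by
      have hc : IsClosed ((fun z : E × E => z.1 + z.2) ⁻¹' (W'.carrier ∩ K₂)) :=
        (W'.proper K₂ hK₂c hr₂U).isClosed.preimage (by fun_prop)
      have hsub : Q ⊆ (fun z : E × E => z.1 + z.2) ⁻¹' (W'.carrier ∩ K₂) := fun y hy =>
        ⟨hy.2.2.2, hQsum y hy.2.1 hy.2.2.1.le⟩
      exact (closure_minimal hsub hc hz).1
    exact ⟨h1, hzΩ, (hshort z h1 hzΩ h2 h3).trans (by linarith), h3⟩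
  have hQloc : IsLocalDiffeo W.carrier Q :=
    isLocalDiffeo_multisection W.isSubmanifold W'.isSubmanifold hΩo
      fun z hz => (hQT z hz).trans_le (by linarith)
  have hQN : Q ⊆ normalBundle W.carrier := fun z hz => hz.1
  have hQM : ∀ z ∈ Q, ‖z.2‖ ≤ δ := fun z hz => hz.2.2.1.le
  refine ⟨Q, hQN, ?_, ?_, hQloc, hQloc.isCoveringMapOn hQN hΩo (fun z hz => hz.2.1) hQM hQcl, ?_, ?_⟩
  · intro z hz
    refine ⟨hz.1, fun y hy => hr₂U (hnear z.1 hz.2.1 y ?_)⟩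
    have h1 : segment ℝ z.1 (z.1 + z.2) ⊆ Metric.closedBall z.1 r :=
      (convex_closedBall z.1 r).segment_subset (Metric.mem_closedBall_self hr0.le)
        (by rw [Metric.mem_closedBall, dist_eq_norm]; simpa using hz.2.2.1.le.trans hδr)
    exact h1 hy
  · intro x hx
    obtain ⟨i, hit, hxi⟩ := mem_iUnion₂.1 (htcov hx)
    have hi := htK i hit
    obtain ⟨y, hyW', hyi⟩ := hH i hit
    obtain ⟨x', hx'N, hx'd⟩ := W.exists_nearest (y := y) hi.1 (fun p hp => hr₂U (by
      rw [Metric.mem_closedBall] at hp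
      refine Metric.mem_cthickening_of_dist_le p i _ _ hi.2 ((dist_triangle p y i).trans ?_)
      have := hsδ i hi
      linarith))
    -- Both `y` to `i` and `y` to its nearest point `x'` are shorter than `s i`, which is why `D i`
    -- was made to contain the ball of radius `2 * s i` in `W`.
    have hx'D : x' ∈ D i := by
      refine hsD i hi ⟨hx'N.1, ?_⟩
      rw [Metric.mem_ball]
      have := dist_triangle_left x' i y
      linarith
    have hx'Q : (x', y - x') ∈ Q := by
      refine ⟨hx'N, (hDΩ i hi hx'D).2, ?_, by simpa using hyW'⟩
      change ‖y - x'‖ < δ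
      rw [← dist_eq_norm]
      exact (hx'd.trans_lt hyi).trans_le (hsδ i hi)
    -- The single point `x'` in the image of `Q` forces the whole connected piece `D i`, and with it
    -- `x`, into the image.
    have hsub := hQloc.subset_image_fst (A := W.carrier ∩ Ω) inter_subset_left
      (fun p hp hpc => mem_image_fst_of_mem_closure hQM hQcl subset_rfl (fun z _ h => h) hp hpc)
      (hDΩ i hi) (hDc i hi) ⟨x', hx'D, _, hx'Q, rfl⟩
    obtain ⟨z, hz, hzx⟩ := hsub (hsD i hi ⟨hx.1, Metric.ball_subset_ball
      (by linarith [hs0 i hi]) hxi⟩)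
    exact ⟨z.2, by rw [← hzx]; exact hz⟩
  · ext y
    constructor
    · rintro ⟨⟨z, hz, rfl⟩, hyK⟩
      exact ⟨hz.2.2.2, hyK⟩
    · rintro ⟨hyW', hyK⟩
      refine ⟨?_, hyK⟩
      obtain ⟨x₀, hx₀W, hx₀⟩ := hN y hyW' (hΩK₂ (hKΩ hyK))
      obtain ⟨x, hxN, hxd⟩ := W.exists_nearest (y := y) hx₀W (fun p hp => hr₂U
        (hnear y (hKΩ hyK) p ((Metric.mem_closedBall.1 hp).trans (by linarith))))
      refine ⟨(x, y - x), ⟨hxN, ?_, ?_, by simpa using hyW'⟩, by simp [normalExp]⟩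
      · exact Metric.mem_thickening_iff.2 ⟨y, hyK, by rw [dist_comm]; linarith⟩
      · change ‖y - x‖ < δ
        rw [← dist_eq_norm]
        linarith
  · intro V f hV hf hfQ x hx
    have hxQ := hfQ x hx
    have hfx : ‖f x‖ < δ := hxQ.2.2.1
    have hev : ∀ᶠ x' in 𝓝[W.carrier ∩ V] x, x' + f x' ∈ W'.carrier := by
      filter_upwards [self_mem_nhdsWithin] with x' hx' using (hfQ x' hx').2.2.2
    refine (W.isSubmanifold.sectionSize_le hV hf hx (hC x ⟨hx.1, hΩK₂ hxQ.2.1⟩) hev ?_ hη1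
      (hQT _ hxQ).le).trans_lt (by linarith)
    exact (mul_le_mul_of_nonneg_left hfx.le hC0).trans hδC

theorem lsTopology_eq_differentialFellTopology :
    (lsTopology U : TopologicalSpace (ProperSubmanifold d U)) = differentialFellTopology U := by
  refine le_antisymm lsTopology_le_differentialFellTopology fun S hS => ?_
  refine (@isOpen_iff_mem_nhds _ (differentialFellTopology U) S).2 fun W hW => ?_
  obtain ⟨K, hK, hKU, ε, hε, h⟩ := hS W hW
  exact mem_of_superset (W.lsNhd_mem_nhds hK hKU hε) h

/-- This is not formal from equality of the topologies: the definition of `topologyOfBasicNhds` does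
not by itself make its basic sets neighbourhoods. That they are is `lsNhd_mem_nhds`. -/
theorem ProperSubmanifold.hasBasis_nhds_differentialFellTopology (W : ProperSubmanifold d U) :
    (@nhds _ (differentialFellTopology U) W).HasBasis
      (fun p : Set E × ℝ => IsCompact p.1 ∧ p.1 ⊆ U ∧ 0 < p.2) (fun p => lsNhd W p.1 p.2) := by
  refine ⟨fun S => ⟨fun hS => ?_, ?_⟩⟩
  · obtain ⟨T, hTS, hT, hWT⟩ := (@mem_nhds_iff _ (differentialFellTopology U) _ _).1 hS
    obtain ⟨K, hK, hKU, ε, hε, h⟩ := lsTopology_le_differentialFellTopology T hT W hWT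
    exact ⟨(K, ε), ⟨hK, hKU, hε⟩, h.trans hTS⟩
  · rintro ⟨⟨K, ε⟩, ⟨hK, hKU, hε⟩, h⟩
    exact mem_of_superset (W.lsNhd_mem_nhds hK hKU hε) h

/-! ### The Galatius--Randal-Williams topology is finer -/

/-- The graph of the global section over a thickening `Ω` of `K` serves as a one-sheeted `Q`.
Displacements are shorter than `r`, so points of `W' ∩ K` come from base points in `Ω`. -/
theorem ProperSubmanifold.exists_gsNhd_subset_lsNhd (W : ProperSubmanifold d U) {K : Set E}
    (hK : IsCompact K) (hKU : K ⊆ U) {ε : ℝ} (hε : 0 < ε) :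
    ∃ K' : Set E, IsCompact K' ∧ K' ⊆ U ∧ ∃ ε' : ℝ, 0 < ε' ∧ gsNhd W K' ε' ⊆ lsNhd W K ε := by
  obtain ⟨r, hr, hrU⟩ := hK.exists_cthickening_subset_open U.isOpen hKU
  set K' := Metric.cthickening r K
  set Ω := Metric.thickening r K with hΩ
  have hΩo : IsOpen Ω := Metric.isOpen_thickening
  have hΩK' : Ω ⊆ K' := Metric.thickening_subset_cthickening r K
  have hKΩ : K ⊆ Ω := Metric.self_subset_thickening hr K
  refine ⟨K', hK.cthickening, hrU, min ε r, by positivity, ?_⟩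
  rintro W' ⟨f, hf, hdom, himg, hsize⟩
  have hfc : ContinuousOn f W.carrier := hf.1.continuousOn
  set Q : Set (E × E) := (fun x => (x, f x)) '' (W.carrier ∩ Ω) with hQ
  have hQN : Q ⊆ normalBundle W.carrier := by
    rintro _ ⟨x, hx, rfl⟩
    exact hf.2 x hx.1
  have hloc : IsLocalDiffeo W.carrier Q := fun z _ =>
    ⟨univ, Ω, f, isOpen_univ, mem_univ z, hΩo, hf.mono inter_subset_left, by rw [inter_univ]⟩
  have hQM : ∀ z ∈ Q, ‖z.2‖ ≤ min ε r := by
    rintro _ ⟨x, hx, rfl⟩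
    exact ((norm_le_sectionSize _ _ _).trans_lt (hsize x hx.1 (Or.inl (hΩK' hx.2)))).le
  have hQcl : ∀ z ∈ closure Q, z.1 ∈ W.carrier ∩ Ω → z ∈ Q := by
    intro z hz hzW
    obtain ⟨u, hu, hlim⟩ := mem_closure_iff_seq_limit.1 hz
    have hu' : ∀ n, (u n).1 ∈ W.carrier ∧ (u n).2 = f (u n).1 := fun n => by
      obtain ⟨x, hx, hxu⟩ := hu n
      rw [← hxu]; exact ⟨hx.1, rfl⟩
    have h1 : Tendsto (fun n => (u n).1) atTop (𝓝[W.carrier] z.1) :=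
      tendsto_nhdsWithin_iff.2 ⟨hlim.fst_nhds, Eventually.of_forall fun n => (hu' n).1⟩
    have h2 : Tendsto (fun n => (u n).2) atTop (𝓝 (f z.1)) :=
      ((hfc z.1 hzW.1).tendsto.comp h1).congr fun n => (hu' n).2.symm
    exact ⟨z.1, hzW, Prod.ext rfl (tendsto_nhds_unique h2 hlim.snd_nhds)⟩
  refine ⟨Q, hQN, ?_, fun x hx => ⟨f x, x, ⟨hx.1, hKΩ hx.2⟩, rfl⟩, hloc,
    hloc.isCoveringMapOn hQN hΩo ?_ hQM hQcl, ?_, ?_⟩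
  · rintro _ ⟨x, hx, rfl⟩
    exact hdom x hx.1
  · rintro _ ⟨x, hx, rfl⟩
    exact hx.2
  · ext y
    constructor
    · rintro ⟨⟨_, ⟨x, hx, rfl⟩, rfl⟩, hyK⟩
      exact ⟨((Set.ext_iff.1 himg _).1 ⟨⟨x, hx.1, rfl⟩, hΩK' (hKΩ hyK)⟩).1, hyK⟩
    · rintro ⟨hyW', hyK⟩
      obtain ⟨⟨x, hxW, rfl⟩, hyK'⟩ := (Set.ext_iff.1 himg y).2 ⟨hyW', hΩK' (hKΩ hyK)⟩
      refine ⟨⟨_, ⟨x, ⟨hxW, ?_⟩, rfl⟩, rfl⟩, hyK⟩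
      -- The base point is not yet known to lie near `K`, so smallness is taken from the clause
      -- about displaced points in `K'`.
      have h1 := (norm_le_sectionSize _ _ _).trans_lt (hsize x hxW (Or.inr hyK'))
      refine Metric.mem_thickening_iff.2 ⟨_, hyK, ?_⟩
      rw [dist_eq_norm]
      simpa [normalExp] using h1.trans_le (min_le_right _ _)
  · intro V g hV hg hgQ x hx
    have hgf : ∀ y ∈ W.carrier ∩ V, y ∈ Ω ∧ g y = f y := fun y hy => by
      obtain ⟨x', hx', h⟩ := hgQ y hy
      have h1 : x' = y := congrArg Prod.fst h
      have h2 : f x' = g y := congrArg Prod.snd h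
      rw [h1] at h2 hx'
      exact ⟨hx'.2, h2.symm⟩
    have h1 : sectionSize W.carrier (W.carrier ∩ V) g x = sectionSize W.carrier W.carrier f x := by
      rw [sectionSize, sectionSize, fderivWithin_congr (fun y hy => (hgf y hy).2) (hgf x hx).2,
        fderivWithin_inter (hV.mem_nhds hx.2), (hgf x hx).2]
    rw [h1]
    exact (hsize x hx.1 (Or.inl (hΩK' (hgf x hx).1))).trans_le (min_le_left _ _)

theorem grwTopology_le_differentialFellTopology :
    (grwTopology U : TopologicalSpace (ProperSubmanifold d U)) ≤ differentialFellTopology U := by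
  rw [← lsTopology_eq_differentialFellTopology]
  intro S hS W hW
  obtain ⟨K, hK, hKU, ε, hε, h⟩ := hS W hW
  obtain ⟨K', hK', hKU', ε', hε', h'⟩ := W.exists_gsNhd_subset_lsNhd hK hKU hε
  exact ⟨K', hK', hKU', ε', hε', h'.trans h⟩

/-! ### The differential Fell topology is Hausdorff -/

theorem ProperSubmanifold.ext_carrier {W W' : ProperSubmanifold d U}
    (h : W.carrier = W'.carrier) : W = W' := by
  cases W; cases W'; cases h; rfl

instance : T2Space (Gr E d) := by
  have hind : IsInducing (fun L : Gr E d => L.1.starProjection) := ⟨rfl⟩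
  exact T2Space.of_injective_continuous
    (fun L L' h => Subtype.ext (Submodule.starProjection_inj.1 h)) hind.continuous

/-- For `x ∈ W` outside `W'`, take a compact neighbourhood `C` of the Gauss point of `x` disjoint
from the closed Gauss image of `W'`. Hitting the interior of `C` and missing `C` are disjoint
conditions. Strictness uses this to know that a convergent sequence together with its limit is
closed. -/
theorem t2Space_differentialFellTopology :
    @T2Space (ProperSubmanifold d U) (differentialFellTopology U) := by
  let _ := differentialFellTopology (d := d) U
  have : LocallyCompactSpace U := U.isOpen.locallyCompactSpace
  have key : ∀ W W' : ProperSubmanifold d U, ∀ x ∈ W.carrier, x ∉ W'.carrier →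
      Disjoint (𝓝 W) (𝓝 W') := by
    intro W W' x hx hx'
    obtain ⟨C, hC, hxC, hCW⟩ := exists_compact_subset (isClosed_gaussImage W').isOpen_compl
      (x := W.gaussPoint hx) fun h => hx' h.1
    refine Filter.disjoint_iff.2 ⟨_, W.eventually_hit isOpen_interior
      ⟨_, W.gaussPoint_mem hx, hxC⟩, _, W'.eventually_miss hC
      (subset_compl_comm.1 hCW), ?_⟩
    rw [Set.disjoint_left]
    rintro V ⟨z, hz, hzC⟩ hV
    exact hV hz (interior_subset hzC)
  refine t2Space_iff_disjoint_nhds.2 fun W W' hne => ?_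
  by_contra hcon
  refine hne (ProperSubmanifold.ext_carrier (Set.ext fun x => ⟨fun hx => ?_, fun hx => ?_⟩))
  · by_contra hx'
    exact hcon (key W W' x hx hx')
  · by_contra hx'
    exact hcon (key W' W x hx hx').symm

/-! ### Unions of parallel affine subspaces -/

/-- The orthogonal projection of `y - x₀` onto the complement of `L`. -/
noncomputable def transverse (L : Submodule ℝ E) (x₀ y : E) : E :=
  Lᗮ.starProjection (y - x₀)

theorem continuous_transverse (L : Submodule ℝ E) (x₀ : E) : Continuous (transverse L x₀) := by
  unfold transverse; fun_prop

theorem transverse_eq_iff (L : Submodule ℝ E) (x₀ y y' : E) :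
    transverse L x₀ y = transverse L x₀ y' ↔ y - y' ∈ L := by
  rw [transverse, transverse, ← sub_eq_zero, ← map_sub, sub_sub_sub_cancel_right,
    Submodule.starProjection_apply_eq_zero_iff, Submodule.orthogonal_orthogonal]

/-- The chart is the translation taking `y` to the origin, restricted to the complement of the other
planes; finiteness of `T` makes that complement open. -/
theorem exists_isSliceChart_planes {L : Submodule ℝ E} (hL : Module.finrank ℝ L = d) (x₀ : E)
    {T : Set E} (hT : T.Finite) {y : E} (hyU : y ∈ U) (hy : transverse L x₀ y ∈ T) :
    ∃ Φ : OpenPartialHomeomorph E E, y ∈ Φ.source ∧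
      IsSliceChart d {y : E | y ∈ U ∧ transverse L x₀ y ∈ T} Φ L ∧
      HasFDerivAt Φ (ContinuousLinearEquiv.refl ℝ E : E →L[ℝ] E) y ∧
      HasFDerivAt Φ.symm ((ContinuousLinearEquiv.refl ℝ E).symm : E →L[ℝ] E) (Φ y) := by
  set S : Set E := U ∩ transverse L x₀ ⁻¹' (T \ {transverse L x₀ y})ᶜ
  have hS : IsOpen S := U.isOpen.inter
    ((hT.subset sdiff_subset).isClosed.isOpen_compl.preimage (continuous_transverse L x₀))
  set Φ := (Homeomorph.addRight (-y)).toOpenPartialHomeomorph.restrOpen S hS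
  have hΦ : ∀ p, Φ p = p + -y := fun p => rfl
  have hΦs : ∀ p, Φ.symm p = p + - -y := fun p => rfl
  have hsrc : ∀ p ∈ Φ.source, p ∈ S := fun p hp => hp.2
  refine ⟨Φ, ⟨mem_univ _, hyU, fun h => h.2 rfl⟩, ⟨hL, ?_, ?_, ?_⟩, ?_, ?_⟩
  · exact (contDiff_id.add contDiff_const).contDiffOn
  · exact (contDiff_id.add contDiff_const).contDiffOn
  · intro p hp
    have hpS := hsrc p hp
    rw [hΦ, ← sub_eq_add_neg, ← transverse_eq_iff L x₀]
    constructor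
    · rintro ⟨-, hpT⟩
      by_contra hne
      exact hpS.2 ⟨hpT, hne⟩
    · intro h
      exact ⟨hpS.1, by rw [h]; exact hy⟩
  · exact (hasFDerivAt_id y).add_const (-y)
  · exact (hasFDerivAt_id _).add_const (- -y)

/-- A finite union of parallel `d`-dimensional affine subspaces, intersected with `U`. -/
noncomputable def planes (U : TopologicalSpace.Opens E) {L : Submodule ℝ E}
    (hL : Module.finrank ℝ L = d) (x₀ : E) (T : Set E) (hT : T.Finite) :
    ProperSubmanifold d U where
  carrier := {y | y ∈ U ∧ transverse L x₀ y ∈ T}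
  subset := fun _ hy => hy.1
  proper := fun K hK hKU => by
    have h : {y | y ∈ U ∧ transverse L x₀ y ∈ T} ∩ K = K ∩ transverse L x₀ ⁻¹' T := by
      ext y
      exact ⟨fun hy => ⟨hy.2, hy.1.2⟩, fun hy => ⟨⟨hKU hy.1, hy.2⟩, hy.1⟩⟩
    rw [h]
    exact hK.inter_right (hT.isClosed.preimage (continuous_transverse L x₀))
  isSubmanifold := fun y hy => by
    obtain ⟨Φ, h1, h2, -⟩ := exists_isSliceChart_planes hL x₀ hT hy.1 hy.2
    exact ⟨Φ, L, h1, h2⟩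

theorem tangentSpace_planes {L : Submodule ℝ E} (hL : Module.finrank ℝ L = d) (x₀ : E)
    {T : Set E} (hT : T.Finite) {y : E} (hy : y ∈ (planes U hL x₀ T hT).carrier) :
    tangentSpace (planes U hL x₀ T hT).carrier y = L := by
  obtain ⟨Φ, h1, h2, h3, h4⟩ := exists_isSliceChart_planes hL x₀ hT hy.1 hy.2
  refine (h2.mem_tangentSpace h1 hy _ h3 h4).trans ?_
  ext v
  rfl

theorem mem_gaussImage_planes {L : Submodule ℝ E} (hL : Module.finrank ℝ L = d) (x₀ : E)
    {T : Set E} (hT : T.Finite) {z : U × Gr E d} :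
    z ∈ gaussImage (planes U hL x₀ T hT) ↔ transverse L x₀ z.1 ∈ T ∧ z.2.1 = L := by
  constructor
  · rintro ⟨h1, h2⟩
    exact ⟨h1.2, h2.trans (tangentSpace_planes hL x₀ hT h1)⟩
  · rintro ⟨h1, h2⟩
    have h3 : (z.1 : E) ∈ (planes U hL x₀ T hT).carrier := ⟨z.1.2, h1⟩
    exact ⟨h3, h2.trans (tangentSpace_planes hL x₀ hT h3).symm⟩

/-- Hit-conditions persist because every term contains the limit plane. For a compact `C` missed by
the limit, the transverse distance is bounded below on the part of `C` with tangent direction `L`,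
and the second plane eventually lies closer than that bound. -/
theorem tendsto_planes {L : Submodule ℝ E} (hL : Module.finrank ℝ L = d) (x₀ : E) {u : ℕ → E}
    (hu : Tendsto u atTop (𝓝 0)) :
    Tendsto (fun k => planes U hL x₀ {0, u k} (by simp)) atTop
      (@nhds _ (differentialFellTopology U) (planes U hL x₀ {0} (by simp))) := by
  rw [differentialFellTopology, @nhds_induced _ _ (fellTopology (U × Gr E d)), tendsto_comap_iff,
    TopologicalSpace.tendsto_nhds_generateFrom_iff]
  rintro _ (⟨O, hO, rfl⟩ | ⟨C, hC, rfl⟩) hW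
  · refine Eventually.of_forall fun k => ?_
    obtain ⟨z, hz, hzO⟩ := hW
    refine ⟨z, ?_, hzO⟩
    have hz' := (mem_gaussImage_planes hL x₀ _).1 hz
    exact (mem_gaussImage_planes hL x₀ _).2 ⟨Or.inl hz'.1, hz'.2⟩
  · have hcl : IsClosed {z : U × Gr E d | z.2 = ⟨L, hL⟩} := isClosed_eq continuous_snd continuous_const
    have hcont : Continuous fun z : U × Gr E d => ‖transverse L x₀ z.1‖ :=
      ((continuous_transverse L x₀).comp (continuous_subtype_val.comp continuous_fst)).norm
    obtain ⟨m, hm, hmC⟩ := (hC.inter_right hcl).exists_forall_le' (a := (0 : ℝ))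
      hcont.continuousOn (fun z hz => by
        refine norm_pos_iff.2 fun h0 => hW (a := z) ?_ hz.1
        exact (mem_gaussImage_planes hL x₀ _).2 ⟨h0, congrArg Subtype.val hz.2⟩)
    filter_upwards [(tendsto_zero_iff_norm_tendsto_zero.1 hu).eventually_lt_const hm] with k hk
    intro z hz hzC
    obtain ⟨h1, h2⟩ := (mem_gaussImage_planes hL x₀ _).1 hz
    have h3 := hmC z ⟨hzC, Subtype.ext h2⟩
    rcases h1 with h1 | h1
    · rw [h1, norm_zero] at h3
      exact hm.not_ge h3
    · rw [mem_singleton_iff.1 h1] at h3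
      exact hk.not_ge h3

/-! ### Strictness -/

/-- The pairs of planes `u k` Fell-converge to the single plane `W`, yet the complement of the
sequence is open for the Galatius--Randal-Williams topology and contains `W`. If that topology were
coarser than or equal to the Fell one, the sequence would have to enter its own complement. -/
theorem not_differentialFellTopology_le_grwTopology (hd : d < Module.finrank ℝ E)
    (hU : (U : Set E).Nonempty) :
    ¬ (differentialFellTopology U : TopologicalSpace (ProperSubmanifold d U)) ≤ grwTopology U := by
  obtain ⟨x₀, hx₀⟩ := hU
  obtain ⟨b, hb⟩ := exists_linearIndependent_of_le_finrank hd.le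
  obtain ⟨L, hL⟩ : ∃ L : Submodule ℝ E, Module.finrank ℝ L = d :=
    ⟨Submodule.span ℝ (range b), by rw [finrank_span_eq_card hb, Fintype.card_fin]⟩
  have hLne : L ≠ ⊤ := by
    rintro rfl
    rw [finrank_top] at hL
    omega
  obtain ⟨e, heL, he0⟩ := Submodule.exists_mem_ne_zero_of_ne_bot
    (fun h => hLne (Submodule.orthogonal_eq_bot_iff.1 h))
  obtain ⟨ρ, hρ, hρU⟩ := Metric.nhds_basis_closedBall.mem_iff.1 (U.isOpen.mem_nhds hx₀)
  -- The scaling keeps `x₀ + c k • e` in the closed `ρ`-ball that serves as the compact set below.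
  set c : ℕ → ℝ := fun k => ρ / ‖e‖ / (k + 1) with hc
  have hepos : 0 < ‖e‖ := norm_pos_iff.2 he0
  have hc0 : ∀ k, 0 < c k := fun k => by positivity
  have hcρ : ∀ k, ‖c k • e‖ ≤ ρ := fun k => by
    rw [norm_smul, Real.norm_of_nonneg (hc0 k).le, hc]
    calc ρ / ‖e‖ / (k + 1) * ‖e‖ = ρ / (k + 1) := by field_simp
      _ ≤ ρ := div_le_self hρ.le (by simp)
  have hlim : Tendsto (fun k => c k • e) atTop (𝓝 0) := by
    have h1 : Tendsto c atTop (𝓝 0) := by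
      have := (tendsto_one_div_add_atTop_nhds_zero_nat (𝕜 := ℝ)).const_mul (ρ / ‖e‖)
      rw [mul_zero] at this
      refine this.congr fun k => ?_
      rw [hc]; ring
    simpa using h1.smul_const e
  set W : ProperSubmanifold d U := planes U hL x₀ {0} (by simp) with hW
  set u : ℕ → ProperSubmanifold d U := fun k => planes U hL x₀ {0, c k • e} (by simp) with hu
  have hball : ∀ k, x₀ + c k • e ∈ Metric.closedBall x₀ ρ := fun k => by
    rw [Metric.mem_closedBall, dist_eq_norm]; simpa using hcρ k
  have htr0 : transverse L x₀ x₀ = 0 := by simp [transverse]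
  have htr : ∀ k, transverse L x₀ (x₀ + c k • e) = c k • e := fun k => by
    rw [transverse, add_sub_cancel_left]
    exact Submodule.starProjection_eq_self_iff.2 (Lᗮ.smul_mem _ heL)
  have hmem : ∀ k, x₀ + c k • e ∈ (u k).carrier := fun k => ⟨hρU (hball k), Or.inr (htr k)⟩
  have hmem0 : ∀ k, x₀ ∈ (u k).carrier := fun k => ⟨hx₀, Or.inl htr0⟩
  have hce : ∀ k, c k • e ≠ 0 := fun k => smul_ne_zero (hc0 k).ne' he0
  have hne : ∀ k, u k ≠ W := by
    intro k h
    have h1 := hmem k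
    rw [h] at h1
    exact hce k ((htr k).symm.trans h1.2)
  have htend : Tendsto u atTop (@nhds _ (differentialFellTopology U) W) := tendsto_planes hL x₀ hlim
  intro hle
  set S : Set (ProperSubmanifold d U) := (range u)ᶜ with hS
  have hSopen : IsOpen[grwTopology U] S := by
    have hcl : IsOpen[differentialFellTopology U] (insert W (range u))ᶜ := by
      let _ := differentialFellTopology (d := d) U
      have : T2Space (ProperSubmanifold d U) := t2Space_differentialFellTopology
      exact htend.isCompact_insert_range.isClosed.isOpen_compl
    -- Away from `W`, openness of `S` comes from the Fell topology, where the sequence with its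
    -- limit is compact and hence closed. Only the point `W` needs an argument about sections.
    have hcl' := grwTopology_le_differentialFellTopology _ hcl
    intro V hV
    by_cases hVW : V = W
    swap
    · obtain ⟨K, hK, hKU, ε, hε, h⟩ := hcl' V (fun h => h.elim hVW hV)
      exact ⟨K, hK, hKU, ε, hε, h.trans (compl_subset_compl.2 (subset_insert _ _))⟩
    -- Any positive number would do in place of `1`: a section of any size is single-valued.
    refine ⟨Metric.closedBall x₀ ρ, isCompact_closedBall _ _, hρU, 1, one_pos, ?_⟩
    subst hVW
    rintro _ ⟨f, hf, -, himg, -⟩ ⟨k, rfl⟩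
    -- a normal section of `W` meets each normal space once
    have huniq : ∀ p ∈ (u k).carrier, p ∈ Metric.closedBall x₀ ρ → p - x₀ ∈ Lᗮ → p = x₀ + f x₀ := by
      intro p hp hpb hpL
      obtain ⟨⟨x, hx, hxp⟩, -⟩ := (Set.ext_iff.1 himg p).2 ⟨hp, hpb⟩
      change x + f x = p at hxp
      have hfx : f x ∈ Lᗮ := by
        have := (hf.2 x hx).2
        rwa [tangentSpace_planes hL x₀ _ hx] at this
      have hxL : x - x₀ ∈ L := by
        rw [← transverse_eq_iff L x₀, htr0]; exact hx.2
      have hxL' : x - x₀ ∈ Lᗮ := by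
        have e1 : x - x₀ = (p - x₀) - f x := by rw [← hxp]; abel
        rw [e1]; exact Lᗮ.sub_mem hpL hfx
      have hxx : x - x₀ = 0 := by
        have h3 : x - x₀ ∈ L ⊓ Lᗮ := ⟨hxL, hxL'⟩
        rwa [L.inf_orthogonal_eq_bot, Submodule.mem_bot] at h3
      rw [← hxp, sub_eq_zero.1 hxx]
    -- The two planes of `u k` give two distinct points in the normal space at `x₀`, both forced to
    -- equal `x₀ + f x₀`.
    have h1 := huniq x₀ (hmem0 k) (Metric.mem_closedBall_self hρ.le) (by simp)
    have h2 := huniq (x₀ + c k • e) (hmem k) (hball k) (by simpa using Lᗮ.smul_mem (c k) heL)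
    rw [← h1] at h2
    exact hce k (by simpa using h2)
  have hS' := hle _ hSopen
  have hWS : W ∈ S := by
    rintro ⟨k, hk⟩
    exact hne k hk
  have hSW : S ∈ @nhds _ (differentialFellTopology U) W := by
    let _ := differentialFellTopology (d := d) U
    exact IsOpen.mem_nhds hS' hWS
  obtain ⟨k, hk⟩ := (htend.eventually hSW).exists
  exact hk ⟨k, rfl⟩

end

end SubmanifoldSpace

theorem theorem4 (n d : ℕ) (U : TopologicalSpace.Opens (EuclideanSpace ℝ (Fin n))) :
    (lsTopology U : TopologicalSpace (ProperSubmanifold d U)) = differentialFellTopology U ∧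
    (∀ W : ProperSubmanifold d U,
      (@nhds _ (differentialFellTopology U) W).HasBasis
        (fun p : Set (EuclideanSpace ℝ (Fin n)) × ℝ => IsCompact p.1 ∧ p.1 ⊆ U ∧ 0 < p.2)
        (fun p => lsNhd W p.1 p.2)) ∧
    (grwTopology U : TopologicalSpace (ProperSubmanifold d U)) ≤ differentialFellTopology U ∧
    (d < n → (U : Set (EuclideanSpace ℝ (Fin n))).Nonempty →
      (grwTopology U : TopologicalSpace (ProperSubmanifold d U)) < differentialFellTopology U) :=
  ⟨lsTopology_eq_differentialFellTopology, fun W => W.hasBasis_nhds_differentialFellTopology,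
    grwTopology_le_differentialFellTopology, fun hd hU =>
      lt_of_le_not_ge grwTopology_le_differentialFellTopology
        (not_differentialFellTopology_le_grwTopology (by simpa using hd) hU)⟩
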